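/- **Setting.** Let $\zeta\in(0,\infty)$, $\beta\in\mathbb R^d$, and let $x_1,x_2,\dots\in\mathbb R^d$ be deterministic. On a probability space let $\tilde T_1,\tilde T_2,\dots$ and $C_1,C_2,\dots$ be mutually independent, where $C_i\in(0,\zeta]$ a.s. and $\Pr(\tilde T_i>t)=\exp\{-e^{x_i^{\mathrm T}\beta}\Lambda_0(t)\}$ for $t\in[0,\zeta]$, with $\Lambda_0(t)=\int_0^t\lambda_0(s)\,ds$, $\lambda_0\ge0$. For each sample size $n$ let $\tau=\tau_n>0$ be such that $\zeta$ is a multiple of $\tau$; put $\Omega=\{\tau,2\tau,\dots,\zeta\}$, $\tilde T_i^*=\tau\lceil\tilde T_i/\tau\rceil$, $C_i^*=\tau\lceil C_i/\tau\rceil$, $T_i^*=\min(\tilde T_i^*,C_i^*)$ and $\delta_i=\mathbf 1(\tilde T_i^*\le C_i^*)$. For $t\in[0,\zeta]$ let $\mathcal R(t)=\{i\le n:T_i^*\ge t\}$, $\mathcal D(t)=\{i\le n:T_i^*=t,\ \delta_i=1\}$, $n(t)=|\mathcal R(t)|$, $d(t)=|\mathcal D(t)|$. Let $S^{(0)}(b,t)=\sum_{i\in\mathcal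 R(t)}e^{x_i^{\mathrm T}b}$, $S^{(1)}(b,t)=\sum_{i\in\mathcal R(t)}e^{x_i^{\mathrm T}b}x_i$, $S^{(2)}(b,t)=\sum_{i\in\mathcal R(t)}e^{x_i^{\mathrm T}b}x_ix_i^{\mathrm T}$. For nonnegative random variables, $X_n=O_{\mathrm P}(Y_n)$ means that $\Pr(X_n>KY_n)\to0$ for some constant $K>0$. Given (random) jumps $d\hat\Lambda(t)$, $t\in\Omega$, let $p_i(b,t)=1-\exp\{-e^{x_i^{\mathrm T}b}\,d\hat\Lambda(t)\}$; the Poisson-binomial partial likelihood is $$L(b)=\prod_{t\in\Omega}\frac{\prod_{i\in\mathcal D(t)}p_i(b,t)\prod_{i\in\mathcal R(t)\setminus\mathcal D(t)}(1-p_i(b,t))}{\sum_{A\subseteq\mathcal R(t),\,|A|=d(t)}\prod_{i\in A}p_i(b,t)\prod_{i\in\mathcal R(t)\setminus A}(1-p_i(b,t))}.$$ The Breslow partial likelihood is $L^{\mathrm b}(b)=\prod_{t\in\Omega}\exp(\sum_{i\in\mathcal D(t)}x_i^{\mathrm T}b)\,d(t)!\,/\,S^{(0)}(b,t)^{d(t)}$,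 and $I_{\mathrm b}(b,\zeta)=-\partial^2\log L^{\mathrm b}(b)/\partial b\,\partial b^{\mathrm T}$. **Theorem.** Assume the following. 1. $n(\zeta)-d(\zeta)\ge1$ with probability tending to one. 2. All $x_i$ lie in one compact set. 3. $\sup_{t\in\Omega}\{\Lambda_0(t)-\Lambda_0(t-\tau)\}=O(\tau)$. 4. $\sup_{t\in[0,\zeta]}|n(t)/n-y(t)|\to0$ almost surely, for some $y:[0,\zeta]\to(0,1]$. 5. There are a bounded open convex neighborhood $\mathcal B$ of $\beta$ and functions $s^{(0)},s^{(1)},s^{(2)}$ on $\mathcal B\times[0,\zeta]$, scalar-, vector- and matrix-valued, such that: $\Lambda_0(\zeta)<\infty$; $\sup_{b\in\mathcal B,\,t\in[0,\zeta]}\|S^{(j)}(b,t)/n-s^{(j)}(b,t)\|_\infty\to0$ in probability for $j=0,1,2$; $s^{(0)}$ is bounded below by a positive constant and all $s^{(j)}$ are bounded; each $s^{(j)}(b,t)$ is continuous in $b\in\mathcal B$ uniformly in $t\in[0,\zeta]$; $s^{(1)}=\partial s^{(0)}/\partial b$ and $s^{(2)}=\partial^2 s^{(0)}/\partial b\,\partial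 b^{\mathrm T}$; and, with $e=s^{(1)}/s^{(0)}$ and $v=s^{(2)}/s^{(0)}-ee^{\mathrm T}$, the matrix $\Sigma(b,\zeta)=\int_0^\zeta v(b,t)\,s^{(0)}(b,t)\,\lambda_0(t)\,dt$ is positive definite for every $b\in\mathcal B$. 6. $\tau\asymp1/n$. 7. $d\hat\Lambda(t)=d(t)/n^*(t)$ for $t\in\Omega$, where $n^*$ is a (random) nonnegative function, nonincreasing on $[0,\zeta]$, with $\sup_{t\in\Omega}n^*(t)=O_{\mathrm P}(n)$ and $\sup_{t\in\Omega}1/n^*(t)=O_{\mathrm P}(1/n)$. Let $\hat\beta_{\mathrm{pb}}$ be such that, with probability tending to one, $\hat\beta_{\mathrm{pb}}\in\mathcal B$ and $\hat\beta_{\mathrm{pb}}$ maximizes $L$ over $\mathcal B$ (for example, a maximizer of $L$ over $\mathbb R^d$ that lies in $\mathcal B$). Then, as $n\to\infty$, $\hat\beta_{\mathrm{pb}}\to\beta$ in probability and $I_{\mathrm b}(\hat\beta_{\mathrm{pb}},\zeta)/n\to\Sigma(\beta,\zeta)$ in probability. -/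

import Mathlib

open Filter Topology MeasureTheory ProbabilityTheory Set
open scoped NNReal ENNReal

namespace GroupedCox

/-! ### Observed survival data with ties -/

/-- Observed data of `n` subjects: covariate vector, observed (event or censoring) time, and
whether the observed time is an event time. -/
structure SurvivalData (d n : ℕ) where
  x : Fin n → EuclideanSpace ℝ (Fin d)
  time : Fin n → ℝ
  event : Fin n → Prop

/-- Rounding up to the grid of mesh `τ`. -/
noncomputable def roundUp (τ a : ℝ) : ℝ := τ * (⌈a / τ⌉ : ℝ)

/-- The grid `{τ, 2τ, …} ∩ (0, ζ]`. -/
noncomputable def grid (τ ζ : ℝ) : Finset ℝ :=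
  (Finset.Icc 1 ⌊ζ / τ⌋₊).image (fun k : ℕ => (k : ℝ) * τ)

/-- The grouped data of the first `n` subjects, from the underlying event times `T` and censoring
times `C`. -/
noncomputable def groupedData {d : ℕ} (x : ℕ → EuclideanSpace ℝ (Fin d)) (T C : ℕ → ℝ)
    (τ : ℝ) (n : ℕ) : SurvivalData d n where
  x i := x i
  time i := min (roundUp τ (T i)) (roundUp τ (C i))
  event i := roundUp τ (T i) ≤ roundUp τ (C i)

namespace SurvivalData

variable {d n : ℕ} (D : SurvivalData d n)

open Classical in
/-- The at-risk set at time `t`. -/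
noncomputable def atRisk (t : ℝ) : Finset (Fin n) :=
  Finset.univ.filter (fun i => t ≤ D.time i)

open Classical in
/-- The set of subjects with an event at time `t`. -/
noncomputable def events (t : ℝ) : Finset (Fin n) :=
  Finset.univ.filter (fun i => D.time i = t ∧ D.event i)

/-- The fitted probability that subject `i` has an event, when the baseline cumulative hazard
jumps by `h`. -/
noncomputable def prob (b : EuclideanSpace ℝ (Fin d)) (h : ℝ) (i : Fin n) : ℝ :=
  1 - Real.exp (-(Real.exp (inner ℝ (D.x i) b) * h))

/-- The probability that, at time `t`, exactly the subjects in `A` have an event. -/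
noncomputable def probExactly (b : EuclideanSpace ℝ (Fin d)) (h t : ℝ) (A : Finset (Fin n)) : ℝ :=
  (∏ i ∈ A, D.prob b h i) * ∏ i ∈ D.atRisk t \ A, (1 - D.prob b h i)

/-- Component at time `t` of the Poisson-binomial partial likelihood: the probability of the
observed event set divided by the Poisson-binomial probability of the observed number of events. -/
noncomputable def pbTerm (b : EuclideanSpace ℝ (Fin d)) (h t : ℝ) : ℝ :=
  D.probExactly b h t (D.events t) /
    ∑ A ∈ (D.atRisk t).powersetCard (D.events t).card, D.probExactly b h t A

/-- The Poisson-binomial partial likelihood up to time `ζ`, with jumps `dLam` of the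
baseline cumulative hazard plugged in. -/
noncomputable def pbLik (τ ζ : ℝ) (dLam : ℝ → ℝ) (b : EuclideanSpace ℝ (Fin d)) : ℝ :=
  ∏ t ∈ grid τ ζ, D.pbTerm b (dLam t) t

noncomputable def S0 (b : EuclideanSpace ℝ (Fin d)) (t : ℝ) : ℝ :=
  ∑ i ∈ D.atRisk t, Real.exp (inner ℝ (D.x i) b)

noncomputable def S1 (b : EuclideanSpace ℝ (Fin d)) (t : ℝ) : EuclideanSpace ℝ (Fin d) :=
  ∑ i ∈ D.atRisk t, Real.exp (inner ℝ (D.x i) b) • D.x i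

noncomputable def S2 (b : EuclideanSpace ℝ (Fin d)) (t : ℝ) : Matrix (Fin d) (Fin d) ℝ :=
  ∑ i ∈ D.atRisk t, Real.exp (inner ℝ (D.x i) b) • Matrix.vecMulVec (D.x i) (D.x i)

/-- Component at time `t` of the Breslow partial likelihood. -/
noncomputable def breslowTerm (b : EuclideanSpace ℝ (Fin d)) (t : ℝ) : ℝ :=
  Real.exp (∑ i ∈ D.events t, inner ℝ (D.x i) b) /
    (D.S0 b t ^ (D.events t).card / ((D.events t).card.factorial : ℝ))

/-- The Breslow partial likelihood up to time `ζ`. -/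
noncomputable def breslowLik (τ ζ : ℝ) (b : EuclideanSpace ℝ (Fin d)) : ℝ :=
  ∏ t ∈ grid τ ζ, D.breslowTerm b t

/-- The Breslow information matrix: minus the Hessian of the logarithm of the Breslow partial
likelihood. -/
noncomputable def breslowInfo (τ ζ : ℝ) (b : EuclideanSpace ℝ (Fin d)) :
    Matrix (Fin d) (Fin d) ℝ :=
  Matrix.of fun k l =>
    -(fderiv ℝ (fun b' => fderiv ℝ (fun b'' => Real.log (D.breslowLik τ ζ b'')) b'
        (EuclideanSpace.single l (1 : ℝ))) b (EuclideanSpace.single k (1 : ℝ)))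

end SurvivalData

/-! ### The underlying continuous failure time model -/

/-- Baseline cumulative hazard with hazard rate `lam`. -/
noncomputable def cumHazard (lam : ℝ → ℝ) (t : ℝ) : ℝ := ∫ s in (0 : ℝ)..t, lam s

/-- Underlying event times `T i` following the Cox model with coefficient vector `β`,
deterministic covariates `x i` and baseline hazard rate `lam`, with independent right censoring at
`C i ∈ (0, ζ]`. All event and censoring times are mutually independent. The law of `T i` is
prescribed on the study period `[0, ζ]` only, since nothing later is ever observed; `t = 0` gives
`T i > 0` almost surely. -/
structure IsCoxModel {Ω : Type*} [MeasurableSpace Ω] (μ : Measure Ω) {d : ℕ} (ζ : ℝ)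
    (β : EuclideanSpace ℝ (Fin d)) (x : ℕ → EuclideanSpace ℝ (Fin d)) (lam : ℝ → ℝ)
    (T C : ℕ → Ω → ℝ) : Prop where
  measurable_T : ∀ i, Measurable (T i)
  measurable_C : ∀ i, Measurable (C i)
  indep : iIndepFun (β := fun _ : ℕ ⊕ ℕ => ℝ) (Sum.elim T C) μ
  hazard_nonneg : ∀ t, 0 ≤ lam t
  survival : ∀ i, ∀ t ∈ Icc (0 : ℝ) ζ, μ.real {ω | t < T i ω} =
    Real.exp (-(Real.exp (inner ℝ (x i) β) * cumHazard lam t))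
  censoring : ∀ i, ∀ᵐ ω ∂μ, C i ω ∈ Ioc (0 : ℝ) ζ

/-! ### Asymptotic notions -/

/-- `X n = O_P (Y n)` for nonnegative random quantities: `Pr (X n > K * Y n) → 0` for some
constant `K > 0`. -/
def IsBigOP {Ω : Type*} [MeasurableSpace Ω] (μ : Measure Ω) (X Y : ℕ → Ω → ℝ≥0∞) : Prop :=
  ∃ K : ℝ≥0, 0 < K ∧ Tendsto (fun n => μ {ω | (K : ℝ≥0∞) * Y n ω < X n ω}) atTop (𝓝 0)

/-- `sup_{b ∈ B, t ∈ [0, ζ]} |F n b t - f b t| → 0` in probability. -/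
def TendstoUnifInProb {Ω : Type*} [MeasurableSpace Ω] (μ : Measure Ω) {d : ℕ}
    (B : Set (EuclideanSpace ℝ (Fin d))) (ζ : ℝ)
    (F : ℕ → Ω → EuclideanSpace ℝ (Fin d) → ℝ → ℝ)
    (f : EuclideanSpace ℝ (Fin d) → ℝ → ℝ) : Prop :=
  ∀ ε > 0, Tendsto (fun n => μ {ω | ∃ b ∈ B, ∃ t ∈ Icc (0 : ℝ) ζ, ε < |F n ω b t - f b t|})
    atTop (𝓝 0)

/-- The limiting covariance `v = s2 / s0 - (s1 / s0) (s1 / s0)ᵀ`. -/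
noncomputable def limitV {d : ℕ} (s0 : EuclideanSpace ℝ (Fin d) → ℝ → ℝ)
    (s1 : EuclideanSpace ℝ (Fin d) → ℝ → EuclideanSpace ℝ (Fin d))
    (s2 : EuclideanSpace ℝ (Fin d) → ℝ → Matrix (Fin d) (Fin d) ℝ)
    (b : EuclideanSpace ℝ (Fin d)) (t : ℝ) : Matrix (Fin d) (Fin d) ℝ :=
  Matrix.of fun k l =>
    s2 b t k l / s0 b t - (s1 b t k / s0 b t) * (s1 b t l / s0 b t)

/-- The matrix `Σ (b, ζ) = ∫_0^ζ v (b, t) s0 (b, t) lam t dt`. -/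
noncomputable def limitSigma {d : ℕ} (s0 : EuclideanSpace ℝ (Fin d) → ℝ → ℝ)
    (s1 : EuclideanSpace ℝ (Fin d) → ℝ → EuclideanSpace ℝ (Fin d))
    (s2 : EuclideanSpace ℝ (Fin d) → ℝ → Matrix (Fin d) (Fin d) ℝ)
    (lam : ℝ → ℝ) (ζ : ℝ) (b : EuclideanSpace ℝ (Fin d)) : Matrix (Fin d) (Fin d) ℝ :=
  Matrix.of fun k l => ∫ t in (0 : ℝ)..ζ, limitV s0 s1 s2 b t k l * s0 b t * lam t

/-- Stability and regularity conditions on a bounded open convex neighborhood `B` of `β`: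
the averages `S0 / n`, `S1 / n`, `S2 / n` of the data `D n ω` converge uniformly in probability to
`s0`, `s1`, `s2`. -/
structure StabilityConditions {Ω : Type*} [MeasurableSpace Ω] (μ : Measure Ω) {d : ℕ} (ζ : ℝ)
    (β : EuclideanSpace ℝ (Fin d)) (lam : ℝ → ℝ) (D : (n : ℕ) → Ω → SurvivalData d n)
    (B : Set (EuclideanSpace ℝ (Fin d))) (s0 : EuclideanSpace ℝ (Fin d) → ℝ → ℝ)
    (s1 : EuclideanSpace ℝ (Fin d) → ℝ → EuclideanSpace ℝ (Fin d))
    (s2 : EuclideanSpace ℝ (Fin d) → ℝ → Matrix (Fin d) (Fin d) ℝ) : Prop where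
  isOpen : IsOpen B
  convex : Convex ℝ B
  isBounded : Bornology.IsBounded B
  mem : β ∈ B
  hazard_integrable : IntervalIntegrable lam volume 0 ζ
  tendsto_S0 : TendstoUnifInProb μ B ζ (fun n ω b t => (D n ω).S0 b t / n) s0
  tendsto_S1 : ∀ k, TendstoUnifInProb μ B ζ (fun n ω b t => (D n ω).S1 b t k / n)
    (fun b t => s1 b t k)
  tendsto_S2 : ∀ k l, TendstoUnifInProb μ B ζ (fun n ω b t => (D n ω).S2 b t k l / n)
    (fun b t => s2 b t k l)
  lower : ∃ m > 0, ∀ b ∈ B, ∀ t ∈ Icc (0 : ℝ) ζ, m < s0 b t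
  upper : ∃ K > 0, ∀ b ∈ B, ∀ t ∈ Icc (0 : ℝ) ζ,
    |s0 b t| ≤ K ∧ (∀ k, |s1 b t k| ≤ K) ∧ ∀ k l, |s2 b t k l| ≤ K
  cont_s0 : EquicontinuousOn (fun (t : Icc (0 : ℝ) ζ) b => s0 b t) B
  cont_s1 : ∀ k, EquicontinuousOn (fun (t : Icc (0 : ℝ) ζ) b => s1 b t k) B
  cont_s2 : ∀ k l, EquicontinuousOn (fun (t : Icc (0 : ℝ) ζ) b => s2 b t k l) B
  deriv_s0 : ∀ b ∈ B, ∀ t ∈ Icc (0 : ℝ) ζ, HasGradientAt (fun b' => s0 b' t) (s1 b t) b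
  deriv_s1 : ∀ b ∈ B, ∀ t ∈ Icc (0 : ℝ) ζ, ∀ k,
    HasGradientAt (fun b' => s1 b' t k) (WithLp.toLp 2 (s2 b t k)) b
  posDef : ∀ b ∈ B, (limitSigma s0 s1 s2 lam ζ b).PosDef

/-- The plugged-in jumps `dLam` of the baseline cumulative hazard have the form
`dLam t = d(t) / n*(t)` on the grid, with `n*` nonnegative and nonincreasing on `[0, ζ]`,
`sup n* = O_P (n)` and `sup (1 / n*) = O_P (1 / n)` over the grid. -/
def IsPlugIn {Ω : Type*} [MeasurableSpace Ω] (μ : Measure Ω) {d : ℕ} (ζ : ℝ) (τ : ℕ → ℝ)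
    (D : (n : ℕ) → Ω → SurvivalData d n) (dLam : ℕ → Ω → ℝ → ℝ) : Prop :=
  ∃ nstar : ℕ → Ω → ℝ → ℝ≥0,
    (∀ n, ∀ᵐ ω ∂μ, AntitoneOn (nstar n ω) (Icc 0 ζ)) ∧
    (∀ n, ∀ᵐ ω ∂μ, ∀ t ∈ grid (τ n) ζ,
      dLam n ω t = (((D n ω).events t).card : ℝ) / (nstar n ω t : ℝ)) ∧
    IsBigOP μ (fun n ω => ⨆ t ∈ grid (τ n) ζ, (nstar n ω t : ℝ≥0∞)) (fun n _ => (n : ℝ≥0∞)) ∧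
    IsBigOP μ (fun n ω => ⨆ t ∈ grid (τ n) ζ, (nstar n ω t : ℝ≥0∞)⁻¹)
      (fun n _ => (n : ℝ≥0∞)⁻¹)

end GroupedCox

/-!
The proof has two ingredients: the Poisson-binomial likelihood may be replaced by the Breslow
likelihood, and the Breslow log-likelihood is concave with known behaviour near `β`.

*Comparison.* In the component at time `t`, the odds `exp (w h) - 1` of a subject with relative
risk `w` lie between `w h` and `w h exp (w h)`, and the elementary symmetric sum of degree `d(t)`
of the relative risks lies between `S0 ^ d(t) / d(t)!` and `(S0 - d(t) W) ^ d(t) / d(t)!`, where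
`W` bounds the relative risks. Since `h` is of order `d(t) / n` and `S0` is of order `n`, the two
components differ by a factor whose logarithm is `O(d(t) ^ 2 / n)` (`pbTerm_bounds`). The total
number of events is at most `n`, so the log-likelihoods differ by `o(n)`, uniformly in `b`, as
soon as no time carries a positive fraction of the events. This follows from Chebyshev's
inequality in each cell of the grid (`highProb_card_events_le`).

*Law of large numbers.* Given that a subject is at risk, the probability of an event in the cell
`(t - τ, t]` is `1 - exp (-w ΔΛ)`. Event indicators minus these probabilities on the risk sets,
weighted by deterministic bounded weights and summed over the grid, are bounded, centred and
independent across subjects. Hence weighted sums over events are close to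
`∑ ΔΛ(t) ∑_{at risk} a_i(t) w_i` (`highProb_sum_events`).
With weights `x_i - s1 / s0` this shows that the score at `β` is `o(n)` (`highProb_score_le`). With
weights `v(β, t)` it shows that the information near `β` is close to `n Σ(β)`
(`highProb_breslowInfo`); there the sum over the grid is compared with the integral without any
regularity of the limits in `t`, because the risk sets are constant on each cell.

*Conclusion.* As `Σ(β)` is positive definite, the information is bounded below by a multiple of
`n` near `β`. Together with the small score and concavity, the Breslow log-likelihood lies below
its value at `β` by a multiple of `n` outside any small ball around `β` (`log_breslowLik_sub_le`).
A maximizer of the Poisson-binomial likelihood cannot lie there, which is consistency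
(`highProb_dist_lt`). The convergence of the information is then its uniform convergence near `β`.
-/

namespace GroupedCox

/-! ### Elementary symmetric sums -/

/-- The recursion for elementary symmetric sums obtained by choosing the last element of the set
among those not yet chosen. -/
theorem sum_powersetCard_prod_succ {ι : Type*} [DecidableEq ι] (R : Finset ι) (w : ι → ℝ) (k : ℕ) :
    ((k : ℝ) + 1) * ∑ A ∈ R.powersetCard (k + 1), ∏ i ∈ A, w i =
      ∑ A ∈ R.powersetCard k, (∏ i ∈ A, w i) * (∑ i ∈ R, w i - ∑ i ∈ A, w i) := by
  have h1 : ∀ A ∈ R.powersetCard k, (∏ i ∈ A, w i) * (∑ i ∈ R, w i - ∑ i ∈ A, w i) =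
      ∑ i ∈ R \ A, (∏ j ∈ insert i A, w j) := by
    intro A hA
    rw [Finset.mem_powersetCard] at hA
    rw [← Finset.sum_sdiff hA.1, add_sub_cancel_right, Finset.mul_sum]
    refine Finset.sum_congr rfl fun i hi => ?_
    rw [Finset.prod_insert (Finset.mem_sdiff.1 hi).2, mul_comm]
  have h2 : ∀ A ∈ R.powersetCard (k + 1), ((k : ℝ) + 1) * ∏ i ∈ A, w i =
      ∑ _i ∈ A, ∏ j ∈ A, w j := by
    intro A hA
    rw [Finset.mem_powersetCard] at hA
    simp [hA.2]
  rw [Finset.mul_sum, Finset.sum_congr rfl h1, Finset.sum_congr rfl h2, Finset.sum_sigma',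
    Finset.sum_sigma']
  refine Finset.sum_bij' (fun p _ => ⟨p.1.erase p.2, p.2⟩) (fun p _ => ⟨insert p.2 p.1, p.2⟩)
    ?_ ?_ ?_ ?_ ?_
  · rintro ⟨A, i⟩ h
    simp only [Finset.mem_sigma, Finset.mem_powersetCard, Finset.mem_sdiff] at h ⊢
    refine ⟨⟨(Finset.erase_subset _ _).trans h.1.1, ?_⟩, h.1.1 h.2, by simp⟩
    rw [Finset.card_erase_of_mem h.2, h.1.2]; rfl
  · rintro ⟨A, i⟩ h
    simp only [Finset.mem_sigma, Finset.mem_powersetCard, Finset.mem_sdiff] at h ⊢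
    refine ⟨⟨Finset.insert_subset h.2.1 h.1.1, ?_⟩, by simp⟩
    rw [Finset.card_insert_of_notMem h.2.2, h.1.2]
  · rintro ⟨A, i⟩ h
    simp only [Finset.mem_sigma] at h
    simp [Finset.insert_erase h.2]
  · rintro ⟨A, i⟩ h
    simp only [Finset.mem_sigma, Finset.mem_sdiff] at h
    simp [Finset.erase_insert h.2.2]
  · rintro ⟨A, i⟩ h
    simp only [Finset.mem_sigma] at h
    simp [Finset.insert_erase h.2]

theorem sum_powersetCard_prod_le {ι : Type*} (R : Finset ι) (w : ι → ℝ)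
    (hw : ∀ i, 0 ≤ w i) (k : ℕ) :
    ∑ A ∈ R.powersetCard k, ∏ i ∈ A, w i ≤ (∑ i ∈ R, w i) ^ k / (k.factorial : ℝ) := by
  classical
  induction k with
  | zero => simp
  | succ k ih =>
    have h := sum_powersetCard_prod_succ R w k
    have hS : 0 ≤ ∑ i ∈ R, w i := Finset.sum_nonneg fun i _ => hw i
    have h2 : ∑ A ∈ R.powersetCard k, (∏ i ∈ A, w i) * (∑ i ∈ R, w i - ∑ i ∈ A, w i) ≤
        (∑ A ∈ R.powersetCard k, ∏ i ∈ A, w i) * ∑ i ∈ R, w i := by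
      rw [Finset.sum_mul]
      refine Finset.sum_le_sum fun A _ => ?_
      refine mul_le_mul_of_nonneg_left ?_ (Finset.prod_nonneg fun i _ => hw i)
      linarith [Finset.sum_nonneg (s := A) fun i _ => hw i]
    have h3 := mul_le_mul_of_nonneg_right ih hS
    rw [Nat.factorial_succ, le_div_iff₀ (by positivity)]
    have hk : (0 : ℝ) < k.factorial := by positivity
    rw [div_mul_eq_mul_div, le_div_iff₀ hk] at h3
    push_cast
    calc _ = (((k : ℝ) + 1) * ∑ A ∈ R.powersetCard (k + 1), ∏ i ∈ A, w i) * k.factorial := by ring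
      _ ≤ ((∑ A ∈ R.powersetCard k, ∏ i ∈ A, w i) * ∑ i ∈ R, w i) * k.factorial := by
        rw [h]; gcongr
      _ ≤ _ := by rw [pow_succ]; exact h3

/-- Drawing `k` distinct elements is nearly the same as drawing `k` elements with replacement,
as long as `k` times the largest weight is small compared with the total weight. -/
theorem le_sum_powersetCard_prod {ι : Type*} (R : Finset ι) (w : ι → ℝ)
    (hw : ∀ i, 0 ≤ w i) {W : ℝ} (hW0 : 0 ≤ W) (hW : ∀ i, w i ≤ W) {m : ℕ}
    (hm : m * W ≤ ∑ i ∈ R, w i) {k : ℕ} (hk : k ≤ m) :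
    (∑ i ∈ R, w i - m * W) ^ k / (k.factorial : ℝ) ≤ ∑ A ∈ R.powersetCard k, ∏ i ∈ A, w i := by
  classical
  induction k with
  | zero => simp
  | succ k ih =>
    have h := sum_powersetCard_prod_succ R w k
    set S := ∑ i ∈ R, w i with hS
    have h2 : (∑ A ∈ R.powersetCard k, ∏ i ∈ A, w i) * (S - m * W) ≤
        ∑ A ∈ R.powersetCard k, (∏ i ∈ A, w i) * (S - ∑ i ∈ A, w i) := by
      rw [Finset.sum_mul]
      refine Finset.sum_le_sum fun A hA => ?_
      refine mul_le_mul_of_nonneg_left ?_ (Finset.prod_nonneg fun i _ => hw i)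
      rw [Finset.mem_powersetCard] at hA
      have h4 : ∑ i ∈ A, w i ≤ k * W := by
        have := Finset.sum_le_card_nsmul A w W fun i _ => hW i
        rwa [hA.2, nsmul_eq_mul] at this
      have : (k : ℝ) * W ≤ m * W := by
        gcongr; omega
      linarith
    have h3 := mul_le_mul_of_nonneg_right (ih (by omega)) (sub_nonneg.2 hm)
    rw [Nat.factorial_succ, div_le_iff₀ (by positivity)]
    have hk : (0 : ℝ) < k.factorial := by positivity
    rw [div_mul_eq_mul_div, div_le_iff₀ hk] at h3
    push_cast
    calc _ ≤ ((∑ A ∈ R.powersetCard k, ∏ i ∈ A, w i) * (S - m * W)) * k.factorial := by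
          rw [pow_succ]; exact h3
      _ ≤ (((k : ℝ) + 1) * ∑ A ∈ R.powersetCard (k + 1), ∏ i ∈ A, w i) * k.factorial := by
        rw [h]; gcongr
      _ = _ := by ring

/-! ### Comparison of the two likelihoods -/

namespace SurvivalData

variable {d n : ℕ} (D : SurvivalData d n)

theorem mem_atRisk {t : ℝ} {i : Fin n} : i ∈ D.atRisk t ↔ t ≤ D.time i := by
  simp [atRisk]

theorem mem_events {t : ℝ} {i : Fin n} : i ∈ D.events t ↔ D.time i = t ∧ D.event i := by
  simp [events]

theorem events_subset_atRisk (t : ℝ) : D.events t ⊆ D.atRisk t := by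
  intro i hi
  exact D.mem_atRisk.2 (D.mem_events.1 hi).1.ge

theorem S0_nonneg (b : EuclideanSpace ℝ (Fin d)) (t : ℝ) : 0 ≤ D.S0 b t :=
  Finset.sum_nonneg fun _ _ => (Real.exp_pos _).le

theorem S0_pos_of_mem_atRisk {b : EuclideanSpace ℝ (Fin d)} {t : ℝ} {i : Fin n}
    (hi : i ∈ D.atRisk t) : 0 < D.S0 b t :=
  Finset.sum_pos (fun _ _ => Real.exp_pos _) ⟨i, hi⟩

theorem S0_pos_of_card_events_ne_zero {b : EuclideanSpace ℝ (Fin d)} {t : ℝ}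
    (h : (D.events t).card ≠ 0) : 0 < D.S0 b t := by
  obtain ⟨i, hi⟩ := Finset.card_ne_zero.1 h
  exact D.S0_pos_of_mem_atRisk (D.events_subset_atRisk t hi)

theorem breslowTerm_pos (b : EuclideanSpace ℝ (Fin d)) (t : ℝ) : 0 < D.breslowTerm b t := by
  unfold breslowTerm
  have : 0 < D.S0 b t ^ (D.events t).card := by
    by_cases h : (D.events t).card = 0
    · simp [h]
    · exact pow_pos (D.S0_pos_of_card_events_ne_zero h) _
  positivity

theorem sum_card_events_le (s : Finset ℝ) : ∑ t ∈ s, ((D.events t).card : ℝ) ≤ n := by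
  classical
  rw [← Nat.cast_sum, ← Finset.card_biUnion]
  · have := Finset.card_le_univ (s.biUnion D.events)
    rw [Fintype.card_fin] at this
    exact_mod_cast this
  · intro t _ t' _ htt
    exact Finset.disjoint_left.2 fun i hi hi' =>
      htt ((D.mem_events.1 hi).1.symm.trans (D.mem_events.1 hi').1)

/-- The fitted odds of an event. -/
noncomputable def odds (b : EuclideanSpace ℝ (Fin d)) (h : ℝ) (i : Fin n) : ℝ :=
  Real.exp (Real.exp (inner ℝ (D.x i) b) * h) - 1

theorem probExactly_eq (b : EuclideanSpace ℝ (Fin d)) (h t : ℝ) {A : Finset (Fin n)}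
    (hA : A ⊆ D.atRisk t) : D.probExactly b h t A =
      (∏ i ∈ D.atRisk t, (1 - D.prob b h i)) * ∏ i ∈ A, D.odds b h i := by
  unfold probExactly
  rw [← Finset.prod_sdiff hA, mul_assoc, ← Finset.prod_mul_distrib, mul_comm]
  congr 1
  refine Finset.prod_congr rfl fun i _ => ?_
  simp only [prob, odds, sub_sub_cancel]
  rw [mul_sub, ← Real.exp_add]
  simp

/-- The factor `∏ (1 - p)` over the risk set cancels, so that only the odds enter. -/
theorem pbTerm_eq (b : EuclideanSpace ℝ (Fin d)) (h t : ℝ) : D.pbTerm b h t =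
    (∏ i ∈ D.events t, D.odds b h i) /
      ∑ A ∈ (D.atRisk t).powersetCard (D.events t).card, ∏ i ∈ A, D.odds b h i := by
  unfold pbTerm
  rw [D.probExactly_eq b h t (D.events_subset_atRisk t), Finset.sum_congr rfl fun A hA =>
    D.probExactly_eq b h t (Finset.mem_powersetCard.1 hA).1, ← Finset.mul_sum]
  refine mul_div_mul_left _ _ (Finset.prod_pos fun i _ => ?_).ne'
  simp only [prob, sub_sub_cancel]
  positivity

/-- For small jumps `h` the odds are nearly proportional to the relative risks. -/
theorem prod_odds_bounds {b : EuclideanSpace ℝ (Fin d)} {h W : ℝ} (hh : 0 ≤ h)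
    (hW : ∀ i, Real.exp (inner ℝ (D.x i) b) ≤ W) (A : Finset (Fin n)) :
    h ^ A.card * ∏ i ∈ A, Real.exp (inner ℝ (D.x i) b) ≤ ∏ i ∈ A, D.odds b h i ∧
    ∏ i ∈ A, D.odds b h i ≤ h ^ A.card * (∏ i ∈ A, Real.exp (inner ℝ (D.x i) b)) *
      Real.exp (A.card * (W * h)) := by
  have key : ∀ y : ℝ, 0 ≤ y → y ≤ Real.exp y - 1 ∧ Real.exp y - 1 ≤ y * Real.exp y := by
    intro y hy
    refine ⟨by linarith [Real.add_one_le_exp y], ?_⟩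
    have h1 := Real.add_one_le_exp (-y)
    have h2 := mul_le_mul_of_nonneg_right h1 (Real.exp_pos y).le
    rw [← Real.exp_add, neg_add_cancel, Real.exp_zero] at h2
    linarith
  rw [← Finset.prod_const, ← Finset.prod_mul_distrib, ← nsmul_eq_mul, ← Finset.sum_const,
    Real.exp_sum, ← Finset.prod_mul_distrib]
  have hnn : ∀ i, 0 ≤ Real.exp (inner ℝ (D.x i) b) * h := fun i => by positivity
  constructor
  · refine Finset.prod_le_prod (fun i _ => by positivity) fun i _ => ?_
    rw [mul_comm]
    exact (key _ (hnn i)).1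
  · refine Finset.prod_le_prod (fun i _ => (hnn i).trans (key _ (hnn i)).1) fun i _ => ?_
    refine (key _ (hnn i)).2.trans ?_
    rw [mul_comm h]
    gcongr
    exact hW i

/-- At a single time, the Poisson-binomial and the Breslow likelihood differ by a factor whose
logarithm is quadratic in the number of events. -/
theorem pbTerm_bounds {b : EuclideanSpace ℝ (Fin d)} {h t W : ℝ} (hW0 : 0 ≤ W) (hh : 0 ≤ h)
    (hh' : (D.events t).card ≠ 0 → 0 < h)
    (hW : ∀ i, Real.exp (inner ℝ (D.x i) b) ≤ W)
    (hS : 2 * ((D.events t).card * W) ≤ D.S0 b t) :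
    0 < D.pbTerm b h t ∧
    |Real.log (D.pbTerm b h t) - Real.log (D.breslowTerm b t)| ≤
      (D.events t).card * (W * h) + 2 * (D.events t).card ^ 2 * W / D.S0 b t := by
  rcases eq_or_ne (D.events t).card 0 with h0 | h0
  · have h0' := Finset.card_eq_zero.1 h0
    have h1 : D.pbTerm b h t = 1 := by rw [pbTerm_eq]; simp [h0']
    have h2 : D.breslowTerm b t = 1 := by unfold breslowTerm; simp [h0']
    rw [h1, h2]; simp [h0]
  have hpos := hh' h0
  have hS0 := D.S0_pos_of_card_events_ne_zero (b := b) h0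
  set k := (D.events t).card with hk
  set w : Fin n → ℝ := fun i => Real.exp (inner ℝ (D.x i) b) with hw
  have hw0 : ∀ i, 0 ≤ w i := fun i => (Real.exp_pos _).le
  set e := ∑ A ∈ (D.atRisk t).powersetCard k, ∏ i ∈ A, w i with he
  set o := ∑ A ∈ (D.atRisk t).powersetCard k, ∏ i ∈ A, D.odds b h i with ho
  set P := ∏ i ∈ D.events t, w i with hP
  set Q := ∏ i ∈ D.events t, D.odds b h i with hQ
  set S := D.S0 b t with hSdef
  have hSw : S = ∑ i ∈ D.atRisk t, w i := rfl
  have hPpos : 0 < P := Finset.prod_pos fun i _ => Real.exp_pos _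
  have hfac : (0 : ℝ) < k.factorial := by positivity
  have heU : e ≤ S ^ k / k.factorial := sum_powersetCard_prod_le _ _ hw0 k
  have heL : (S - k * W) ^ k / k.factorial ≤ e :=
    le_sum_powersetCard_prod _ _ hw0 hW0 hW (by rw [← hSw]; nlinarith) le_rfl
  have hx : k * W / S ≤ 1 / 2 := by rw [div_le_iff₀ hS0]; linarith
  have hx0 : 0 ≤ k * W / S := by positivity
  -- `exp (-2 y) ≤ 1 - y` for `0 ≤ y ≤ 1 / 2`
  have hexp : Real.exp (-(2 * (k * W / S))) ≤ 1 - k * W / S := by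
    have h1 : 0 < 1 + 2 * (k * W / S) := by positivity
    rw [Real.exp_neg, inv_le_comm₀ (Real.exp_pos _) (by linarith)]
    refine le_trans ?_ (Real.add_one_le_exp _)
    rw [inv_le_comm₀ (by linarith) (by linarith), inv_le_iff_one_le_mul₀ (by linarith)]
    nlinarith
  have heL2 : Real.exp (-(2 * k ^ 2 * W / S)) * (S ^ k / k.factorial) ≤ e := by
    refine le_trans ?_ heL
    have h1 : Real.exp (-(2 * k ^ 2 * W / S)) = Real.exp (-(2 * (k * W / S))) ^ k := by
      rw [← Real.exp_nat_mul]; congr 1; ring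
    rw [h1, mul_div_assoc', ← mul_pow]
    gcongr
    calc _ ≤ (1 - k * W / S) * S := by gcongr
      _ = _ := by field_simp
  have hSk : 0 < S ^ k / k.factorial := by positivity
  have he0 : 0 < e := lt_of_lt_of_le (by positivity) heL2
  have hoB : h ^ k * e ≤ o ∧ o ≤ h ^ k * e * Real.exp (k * (W * h)) := by
    rw [he, ho, Finset.mul_sum, Finset.sum_mul]
    constructor <;> refine Finset.sum_le_sum fun A hA => ?_
    · have := (D.prod_odds_bounds hh hW A).1
      rwa [(Finset.mem_powersetCard.1 hA).2] at this
    · have := (D.prod_odds_bounds hh hW A).2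
      rwa [(Finset.mem_powersetCard.1 hA).2] at this
  have hQB := D.prod_odds_bounds hh hW (D.events t)
  change h ^ k * P ≤ Q ∧ Q ≤ h ^ k * P * Real.exp (k * (W * h)) at hQB
  have hhk : 0 < h ^ k := pow_pos hpos k
  have hQ0 : 0 < Q := lt_of_lt_of_le (by positivity) hQB.1
  have ho0 : 0 < o := lt_of_lt_of_le (by positivity) hoB.1
  have hpb : D.pbTerm b h t = Q / o := D.pbTerm_eq b h t
  have hbr : D.breslowTerm b t = P / (S ^ k / k.factorial) := by
    unfold breslowTerm
    rw [Real.exp_sum]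
  rw [hpb, hbr, Real.log_div hQ0.ne' ho0.ne', Real.log_div hPpos.ne' hSk.ne']
  refine ⟨by positivity, ?_⟩
  have l1 := Real.log_le_log (by positivity) hQB.1
  have l2 := Real.log_le_log hQ0 hQB.2
  have l3 := Real.log_le_log (by positivity) hoB.1
  have l4 := Real.log_le_log ho0 hoB.2
  have l5 := Real.log_le_log he0 heU
  have l6 := Real.log_le_log (by positivity) heL2
  rw [Real.log_mul (by positivity) (by positivity)] at l1 l2 l3 l4 l6
  rw [Real.log_mul (by positivity) (by positivity)] at l2 l4
  rw [Real.log_exp] at l2 l4 l6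
  rw [abs_le]
  constructor <;> linarith

/-- If the risk sets are of order `n`, the jumps are of order `(number of events) / n` and no time
has more than `ε n` events, then the two log-likelihoods differ by `O(ε n)`. -/
theorem abs_log_pbLik_sub_log_breslowLik_le {b : EuclideanSpace ℝ (Fin d)} {τ ζ W K m ε : ℝ}
    {dLam : ℝ → ℝ} (hW0 : 0 ≤ W) (hK : 0 ≤ K) (hm : 0 < m) (hε : 2 * (ε * W) ≤ m) (hε0 : 0 ≤ ε)
    (hW : ∀ i, Real.exp (inner ℝ (D.x i) b) ≤ W)
    (hS : ∀ t ∈ grid τ ζ, m * n ≤ D.S0 b t)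
    (hL0 : ∀ t ∈ grid τ ζ, 0 ≤ dLam t)
    (hL0' : ∀ t ∈ grid τ ζ, (D.events t).card ≠ 0 → 0 < dLam t)
    (hL : ∀ t ∈ grid τ ζ, dLam t * n ≤ K * (D.events t).card)
    (hd : ∀ t ∈ grid τ ζ, ((D.events t).card : ℝ) ≤ ε * n) :
    0 < D.pbLik τ ζ dLam b ∧
    |Real.log (D.pbLik τ ζ dLam b) - Real.log (D.breslowLik τ ζ b)| ≤
      ε * (W * K + 2 * W / m) * n := by
  rcases Nat.eq_zero_or_pos n with hn | hn
  · subst hn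
    have he : ∀ t, D.events t = ∅ := fun t => by ext i; exact i.elim0
    simp [pbLik, breslowLik, pbTerm_eq, breslowTerm, he]
  have hn' : (0 : ℝ) < n := by exact_mod_cast hn
  have key : ∀ t ∈ grid τ ζ, 0 < D.pbTerm b (dLam t) t ∧
      |Real.log (D.pbTerm b (dLam t) t) - Real.log (D.breslowTerm b t)| ≤
        ε * (W * K + 2 * W / m) * (D.events t).card := by
    intro t ht
    obtain ⟨h1, h2⟩ := D.pbTerm_bounds hW0 (hL0 t ht) (hL0' t ht) hW (t := t) (by
      have h1 := mul_le_mul_of_nonneg_right (hd t ht) hW0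
      have h2 := mul_le_mul_of_nonneg_right hε hn'.le
      have h3 := hS t ht
      linarith)
    refine ⟨h1, h2.trans ?_⟩
    set k : ℝ := ((D.events t).card : ℝ) with hk
    have hk0 : 0 ≤ k := by positivity
    have hmn : 0 < m * n := by positivity
    have h3 : k * (W * dLam t) ≤ ε * (W * K) * k := by
      have h4 : k * dLam t ≤ ε * (K * k) := by
        calc _ ≤ ε * n * dLam t := mul_le_mul_of_nonneg_right (hd t ht) (hL0 t ht)
          _ = ε * (dLam t * n) := by ring
          _ ≤ _ := mul_le_mul_of_nonneg_left (hL t ht) hε0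
      nlinarith [mul_le_mul_of_nonneg_left h4 hW0]
    have h5 : 2 * k ^ 2 * W / D.S0 b t ≤ ε * (2 * W / m) * k := by
      calc _ ≤ 2 * k ^ 2 * W / (m * n) := by
            gcongr; exact hS t ht
        _ ≤ 2 * (k * (ε * n)) * W / (m * n) := by
            gcongr; rw [sq]; gcongr; exact hd t ht
        _ = _ := by field_simp
    linarith
  unfold pbLik breslowLik
  refine ⟨Finset.prod_pos fun t ht => (key t ht).1, ?_⟩
  rw [Real.log_prod fun t ht => (key t ht).1.ne',
    Real.log_prod fun t _ => (D.breslowTerm_pos b t).ne', ← Finset.sum_sub_distrib]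
  refine (Finset.abs_sum_le_sum_abs _ _).trans
    ((Finset.sum_le_sum fun t ht => (key t ht).2).trans ?_)
  rw [← Finset.mul_sum]
  exact mul_le_mul_of_nonneg_left (D.sum_card_events_le _) (by positivity)

end SurvivalData

/-! ### Derivatives of the Breslow likelihood -/

namespace SurvivalData

variable {d n : ℕ} (D : SurvivalData d n)

/-- The unnormalized second moment of `⟪x, u⟫` and `⟪x, v⟫` over the risk set. -/
noncomputable def moment₂ (b : EuclideanSpace ℝ (Fin d)) (t : ℝ) (u v : EuclideanSpace ℝ (Fin d)) :
    ℝ :=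
  ∑ i ∈ D.atRisk t, Real.exp (inner ℝ (D.x i) b) * inner ℝ (D.x i) u * inner ℝ (D.x i) v

/-- The weighted covariance of `⟪x, u⟫` and `⟪x, v⟫` over the risk set. -/
noncomputable def cov (b : EuclideanSpace ℝ (Fin d)) (t : ℝ) (u v : EuclideanSpace ℝ (Fin d)) :
    ℝ :=
  D.moment₂ b t u v / D.S0 b t -
    (inner ℝ (D.S1 b t) u / D.S0 b t) * (inner ℝ (D.S1 b t) v / D.S0 b t)

/-- The derivative of the logarithm of the Breslow likelihood in direction `u`. -/
noncomputable def score (τ ζ : ℝ) (b u : EuclideanSpace ℝ (Fin d)) : ℝ :=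
  ∑ t ∈ grid τ ζ, (∑ i ∈ D.events t, inner ℝ (D.x i) u -
    (D.events t).card * (inner ℝ (D.S1 b t) u / D.S0 b t))

/-- Minus the second derivative of the logarithm of the Breslow likelihood in directions
`u` and `v`. -/
noncomputable def info (τ ζ : ℝ) (b u v : EuclideanSpace ℝ (Fin d)) : ℝ :=
  ∑ t ∈ grid τ ζ, (D.events t).card * D.cov b t u v

theorem inner_S1 (b : EuclideanSpace ℝ (Fin d)) (t : ℝ) (u : EuclideanSpace ℝ (Fin d)) :
    inner ℝ (D.S1 b t) u =
      ∑ i ∈ D.atRisk t, Real.exp (inner ℝ (D.x i) b) * inner ℝ (D.x i) u := by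
  simp [S1, sum_inner, real_inner_smul_left]

/-- This is the Cauchy-Schwarz inequality. With an empty risk set both terms are `0`. -/
theorem cov_self_nonneg (b : EuclideanSpace ℝ (Fin d)) (t : ℝ) (u : EuclideanSpace ℝ (Fin d)) :
    0 ≤ D.cov b t u u := by
  unfold cov
  rcases (D.S0_nonneg b t).eq_or_lt with h | h
  · simp [← h]
  · have hcs := Finset.sum_mul_sq_le_sq_mul_sq (D.atRisk t)
      (fun i => Real.sqrt (Real.exp (inner ℝ (D.x i) b)))
      (fun i => Real.sqrt (Real.exp (inner ℝ (D.x i) b)) * inner ℝ (D.x i) u)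
    simp only [← mul_assoc, mul_pow, Real.sq_sqrt (Real.exp_pos _).le,
      Real.mul_self_sqrt (Real.exp_pos _).le] at hcs
    rw [← D.inner_S1] at hcs
    have h2 : D.moment₂ b t u u =
        ∑ i ∈ D.atRisk t, Real.exp (inner ℝ (D.x i) b) * inner ℝ (D.x i) u ^ 2 :=
      Finset.sum_congr rfl fun i _ => by ring
    rw [← h2] at hcs
    change _ ≤ D.S0 b t * _ at hcs
    rw [sub_nonneg, div_mul_div_comm, div_le_div_iff₀ (by positivity) h]
    nlinarith

/-- This holds also at times with an empty risk set, as these have no events. -/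
theorem log_breslowLik (τ ζ : ℝ) (b : EuclideanSpace ℝ (Fin d)) :
    Real.log (D.breslowLik τ ζ b) = ∑ t ∈ grid τ ζ, (∑ i ∈ D.events t, inner ℝ (D.x i) b -
      (D.events t).card * Real.log (D.S0 b t) + Real.log ((D.events t).card.factorial : ℝ)) := by
  unfold breslowLik
  rw [Real.log_prod fun t _ => (D.breslowTerm_pos b t).ne']
  refine Finset.sum_congr rfl fun t _ => ?_
  unfold breslowTerm
  have hS : D.S0 b t ^ (D.events t).card ≠ 0 := by
    by_cases h : (D.events t).card = 0
    · simp [h]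
    · exact (pow_pos (D.S0_pos_of_card_events_ne_zero h) _).ne'
  rw [Real.log_div (Real.exp_pos _).ne' (by positivity), Real.log_exp,
    Real.log_div hS (by positivity), Real.log_pow]
  ring

theorem hasFDerivAt_exp_inner (a b : EuclideanSpace ℝ (Fin d)) :
    HasFDerivAt (fun b' : EuclideanSpace ℝ (Fin d) => Real.exp (inner ℝ a b'))
      (Real.exp (inner ℝ a b) • innerSL ℝ a) b := by
  have h : HasFDerivAt (fun b' : EuclideanSpace ℝ (Fin d) => inner ℝ a b') (innerSL ℝ a) b :=
    (innerSL ℝ a).hasFDerivAt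
  exact h.exp

theorem hasFDerivAt_S0 (b : EuclideanSpace ℝ (Fin d)) (t : ℝ) :
    HasFDerivAt (fun b' => D.S0 b' t) (innerSL ℝ (D.S1 b t)) b := by
  have h := HasFDerivAt.fun_sum (u := D.atRisk t) fun i _ => hasFDerivAt_exp_inner (D.x i) b
  refine h.congr_fderiv ?_
  ext v
  simp [D.inner_S1]

theorem hasFDerivAt_inner_S1 (b u : EuclideanSpace ℝ (Fin d)) (t : ℝ) :
    HasFDerivAt (fun b' => inner ℝ (D.S1 b' t) u)
      (∑ i ∈ D.atRisk t, inner ℝ (D.x i) u • Real.exp (inner ℝ (D.x i) b) • innerSL ℝ (D.x i))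
      b := by
  simp only [D.inner_S1]
  exact HasFDerivAt.fun_sum fun i _ => (hasFDerivAt_exp_inner (D.x i) b).mul_const _

theorem hasFDerivAt_log_breslowLik (τ ζ : ℝ) (b : EuclideanSpace ℝ (Fin d)) :
    ∃ L : EuclideanSpace ℝ (Fin d) →L[ℝ] ℝ,
      HasFDerivAt (fun b' => Real.log (D.breslowLik τ ζ b')) L b ∧
      ∀ u, L u = D.score τ ζ b u := by
  refine ⟨∑ t ∈ grid τ ζ, (∑ i ∈ D.events t, innerSL ℝ (D.x i) -
    ((D.events t).card : ℝ) • (D.S0 b t)⁻¹ • innerSL ℝ (D.S1 b t)), ?_, ?_⟩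
  · simp only [D.log_breslowLik]
    refine HasFDerivAt.fun_sum fun t _ => ?_
    refine HasFDerivAt.add_const _ (HasFDerivAt.sub ?_ ?_)
    · exact HasFDerivAt.fun_sum fun i _ => (innerSL ℝ (D.x i)).hasFDerivAt
    · by_cases h : (D.events t).card = 0
      · simp only [h, Nat.cast_zero, zero_mul, zero_smul]
        exact hasFDerivAt_const _ _
      · exact ((D.hasFDerivAt_S0 b t).log (D.S0_pos_of_card_events_ne_zero h).ne').const_mul _
  · intro u
    simp [score, div_eq_inv_mul, sub_eq_add_neg]

theorem hasFDerivAt_score (τ ζ : ℝ) (b u : EuclideanSpace ℝ (Fin d)) :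
    ∃ L : EuclideanSpace ℝ (Fin d) →L[ℝ] ℝ,
      HasFDerivAt (fun b' => D.score τ ζ b' u) L b ∧ ∀ v, L v = -D.info τ ζ b u v := by
  have key : ∀ t, ∃ L : EuclideanSpace ℝ (Fin d) →L[ℝ] ℝ,
      HasFDerivAt (fun b' => ∑ i ∈ D.events t, inner ℝ (D.x i) u -
        (D.events t).card * (inner ℝ (D.S1 b' t) u / D.S0 b' t)) L b ∧
      ∀ v, L v = -((D.events t).card * D.cov b t u v) := by
    intro t
    by_cases h : (D.events t).card = 0
    · refine ⟨0, ?_, by simp [h]⟩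
      simp only [h, Nat.cast_zero, zero_mul]
      exact hasFDerivAt_const _ _
    · have hS := D.S0_pos_of_card_events_ne_zero (b := b) h
      refine ⟨_, (((D.hasFDerivAt_inner_S1 b u t).mul ((hasDerivAt_inv hS.ne').comp_hasFDerivAt b
        (D.hasFDerivAt_S0 b t))).const_mul _).const_sub _, fun v => ?_⟩
      have h2 : (∑ i ∈ D.atRisk t, inner ℝ (D.x i) u * (Real.exp (inner ℝ (D.x i) b) *
          inner ℝ (D.x i) v)) = D.moment₂ b t u v :=
        Finset.sum_congr rfl fun i _ => by ring
      simp [h2, cov]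
      field_simp
      ring
  choose L hL hL' using key
  refine ⟨∑ t ∈ grid τ ζ, L t, HasFDerivAt.fun_sum fun t _ => hL t, fun v => ?_⟩
  simp [hL', info]

theorem cov_single (b : EuclideanSpace ℝ (Fin d)) (t : ℝ) (k l : Fin d) :
    D.cov b t (EuclideanSpace.single k 1) (EuclideanSpace.single l 1) =
      limitV D.S0 D.S1 D.S2 b t k l := by
  have h : D.moment₂ b t (EuclideanSpace.single k 1) (EuclideanSpace.single l 1) =
      D.S2 b t k l := by
    simp [moment₂, S2, Matrix.sum_apply, Matrix.vecMulVec_apply, mul_assoc,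
      EuclideanSpace.inner_single_right]
  simp [cov, h, limitV, EuclideanSpace.inner_single_right]

theorem breslowInfo_eq (τ ζ : ℝ) (b : EuclideanSpace ℝ (Fin d)) (k l : Fin d) :
    D.breslowInfo τ ζ b k l =
      ∑ t ∈ grid τ ζ, (D.events t).card * limitV D.S0 D.S1 D.S2 b t k l := by
  have h1 : ∀ b', fderiv ℝ (fun b'' => Real.log (D.breslowLik τ ζ b'')) b'
      (EuclideanSpace.single l (1 : ℝ)) = D.score τ ζ b' (EuclideanSpace.single l (1 : ℝ)) := by
    intro b'
    obtain ⟨L, hL, hL'⟩ := D.hasFDerivAt_log_breslowLik τ ζ b'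
    rw [hL.fderiv, hL']
  simp only [breslowInfo, Matrix.of_apply, h1]
  obtain ⟨L, hL, hL'⟩ := D.hasFDerivAt_score τ ζ b (EuclideanSpace.single l (1 : ℝ))
  rw [hL.fderiv, hL', neg_neg, info]
  refine Finset.sum_congr rfl fun t _ => ?_
  rw [← D.cov_single b t k l, cov, cov, mul_comm (inner ℝ _ _ / _)]
  congr 3
  exact Finset.sum_congr rfl fun i _ => by ring

/-- The information as a quadratic form. -/
theorem info_eq_sum (τ ζ : ℝ) (b u : EuclideanSpace ℝ (Fin d)) :
    D.info τ ζ b u u = ∑ k, ∑ l, u k * u l * D.breslowInfo τ ζ b k l := by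
  have hin : ∀ a : EuclideanSpace ℝ (Fin d), inner ℝ a u = ∑ k, u k * a k := fun a => by
    simp [PiLp.inner_apply]
  have hcov : ∀ t, D.cov b t u u = ∑ k, ∑ l, u k * u l * limitV D.S0 D.S1 D.S2 b t k l := by
    intro t
    have hm : D.moment₂ b t u u = ∑ k, ∑ l, u k * u l * D.S2 b t k l := by
      simp only [S2, Matrix.sum_apply, Matrix.smul_apply, Matrix.vecMulVec_apply, Finset.mul_sum,
        smul_eq_mul]
      have h : ∀ k, ∑ l, ∑ i ∈ D.atRisk t, u k * u l *
          (Real.exp (inner ℝ (D.x i) b) * (D.x i k * D.x i l)) = ∑ i ∈ D.atRisk t, ∑ l, u k * u l *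
          (Real.exp (inner ℝ (D.x i) b) * (D.x i k * D.x i l)) := fun k => Finset.sum_comm
      simp only [h]
      rw [Finset.sum_comm]
      refine Finset.sum_congr rfl fun i _ => ?_
      rw [mul_assoc, hin, Finset.sum_mul_sum, Finset.mul_sum]
      refine Finset.sum_congr rfl fun k _ => ?_
      rw [Finset.mul_sum]
      refine Finset.sum_congr rfl fun l _ => by ring
    simp only [cov, hm, hin, limitV, Matrix.of_apply]
    simp only [mul_sub, Finset.sum_sub_distrib]
    congr 1
    · simp only [Finset.sum_div, mul_div_assoc]
    · rw [Finset.sum_div, Finset.sum_mul_sum]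
      refine Finset.sum_congr rfl fun k _ => Finset.sum_congr rfl fun l _ => by ring
  simp only [info, breslowInfo_eq, hcov, Finset.mul_sum]
  rw [Finset.sum_comm]
  refine Finset.sum_congr rfl fun k _ => ?_
  rw [Finset.sum_comm]
  refine Finset.sum_congr rfl fun l _ => Finset.sum_congr rfl fun t _ => by ring

end SurvivalData

/-- A function with nonpositive second derivative, strictly concave near `0` and almost flat at
`0`, has dropped by a fixed amount at distance `r` and beyond. -/
theorem concave_drop {f f' f'' : ℝ → ℝ} (hf : ∀ s, HasDerivAt f (f' s) s)
    (hf' : ∀ s, HasDerivAt f' (f'' s) s) {c r : ℝ} (hc : 0 < c) (hr : 0 < r)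
    (h0 : f' 0 ≤ c * r / 4) (hneg : ∀ s, f'' s ≤ 0) (hneg' : ∀ s ∈ Icc 0 r, f'' s ≤ -c)
    {s : ℝ} (hs : r ≤ s) : f s - f 0 ≤ -(c * r ^ 2 / 4) := by
  -- `f'` decreases with slope at least `c` on `[0, r]`
  have h1 : AntitoneOn (fun s => f' s + c * s) (Icc 0 r) := by
    refine antitoneOn_of_hasDerivWithinAt_nonpos (f' := fun s => f'' s + c * 1) (convex_Icc 0 r)
      (fun s _ => ((hf' s).add ((hasDerivAt_id s).const_mul c)).continuousAt.continuousWithinAt)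
      (fun s _ => ((hf' s).add ((hasDerivAt_id s).const_mul c)).hasDerivWithinAt) ?_
    intro s hs
    rw [interior_Icc] at hs
    have := hneg' s (Ioo_subset_Icc_self hs)
    linarith
  have h2 : ∀ s ∈ Icc 0 r, f' s + c * s ≤ c * r / 4 := by
    intro s hs
    have := h1 (left_mem_Icc.2 hr.le) hs hs.1
    simp only [mul_zero, add_zero] at this
    linarith
  have hd : ∀ s, HasDerivAt (fun s => f s - c * r / 4 * s + c / 2 * s ^ 2)
      (f' s - c * r / 4 + c * s) s := by
    intro s
    have := ((hf s).sub ((hasDerivAt_id s).const_mul (c * r / 4))).add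
      ((hasDerivAt_pow 2 s).const_mul (c / 2))
    refine this.congr_deriv ?_
    simp; ring
  have h3 : AntitoneOn (fun s => f s - c * r / 4 * s + c / 2 * s ^ 2) (Icc 0 r) := by
    refine antitoneOn_of_hasDerivWithinAt_nonpos (convex_Icc 0 r)
      (fun s _ => (hd s).continuousAt.continuousWithinAt)
      (fun s _ => (hd s).hasDerivWithinAt) ?_
    intro s hs
    rw [interior_Icc] at hs
    have := h2 s (Ioo_subset_Icc_self hs)
    linarith
  have h4 := h3 (left_mem_Icc.2 hr.le) (right_mem_Icc.2 hr.le) hr.le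
  have hanti : Antitone f' := antitone_of_hasDerivAt_nonpos hf' hneg
  have h5 : AntitoneOn f (Ici r) := by
    refine antitoneOn_of_hasDerivWithinAt_nonpos (convex_Ici r)
      (fun s _ => (hf s).continuousAt.continuousWithinAt)
      (fun s _ => (hf s).hasDerivWithinAt) ?_
    intro s hs
    rw [interior_Ici] at hs
    have h6 := h2 r (right_mem_Icc.2 hr.le)
    have h7 := hanti (le_of_lt (mem_Ioi.1 hs))
    nlinarith
  have h8 := h5 (mem_Ici.2 le_rfl) (mem_Ici.2 hs) hs
  simp only [mul_zero, sub_zero] at h4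
  nlinarith

namespace SurvivalData

variable {d n : ℕ} (D : SurvivalData d n)

/-- If the score at `β` is small and the information is bounded below near `β`, then the Breslow
likelihood is much smaller away from `β` than at `β`. -/
theorem log_breslowLik_sub_le {τ ζ c r : ℝ} {β b : EuclideanSpace ℝ (Fin d)} (hn : 0 < n)
    (hc : 0 < c) (hr : 0 < r)
    (hscore : ∀ u : EuclideanSpace ℝ (Fin d), ‖u‖ = 1 → D.score τ ζ β u ≤ c * r / 4 * n)
    (hinfo : ∀ b', dist b' β ≤ r → ∀ u : EuclideanSpace ℝ (Fin d), ‖u‖ = 1 →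
      c * n ≤ D.info τ ζ b' u u) (hb : r ≤ dist b β) :
    Real.log (D.breslowLik τ ζ b) - Real.log (D.breslowLik τ ζ β) ≤ -(c * r ^ 2 / 4 * n) := by
  have hn' : (0 : ℝ) < n := by exact_mod_cast hn
  have hpos : 0 < ‖b - β‖ := by rw [← dist_eq_norm]; linarith
  set u : EuclideanSpace ℝ (Fin d) := ‖b - β‖⁻¹ • (b - β) with hu
  have hu1 : ‖u‖ = 1 := by
    rw [hu, norm_smul, norm_inv, norm_norm, inv_mul_cancel₀ hpos.ne']
  have hline : ∀ s : ℝ, HasDerivAt (fun s : ℝ => β + s • u) u s := by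
    intro s
    simpa using ((hasDerivAt_id s).smul_const u).const_add β
  have h1 : ∀ s : ℝ, HasDerivAt (fun s => Real.log (D.breslowLik τ ζ (β + s • u)))
      (D.score τ ζ (β + s • u) u) s := by
    intro s
    obtain ⟨L, hL, hL'⟩ := D.hasFDerivAt_log_breslowLik τ ζ (β + s • u)
    rw [← hL']
    exact hL.comp_hasDerivAt s (hline s)
  have h2 : ∀ s : ℝ, HasDerivAt (fun s => D.score τ ζ (β + s • u) u)
      (-D.info τ ζ (β + s • u) u u) s := by
    intro s
    obtain ⟨L, hL, hL'⟩ := D.hasFDerivAt_score τ ζ (β + s • u) u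
    rw [← hL']
    exact HasFDerivAt.comp_hasDerivAt s hL (hline s)
  have := concave_drop h1 h2 (c := c * n) (r := r) (by positivity) hr (by
      simp only [zero_smul, add_zero]; have := hscore u hu1; linarith) (fun s => by
      rw [neg_nonpos]
      exact Finset.sum_nonneg fun t _ => mul_nonneg (by positivity) (D.cov_self_nonneg _ _ _))
    (fun s hs => by
      refine neg_le_neg (hinfo _ ?_ u hu1)
      rw [dist_eq_norm, add_sub_cancel_left, norm_smul, hu1, mul_one, Real.norm_eq_abs,
        abs_of_nonneg hs.1]
      exact hs.2) (s := ‖b - β‖) (by rwa [← dist_eq_norm])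
  simp only [zero_smul, add_zero] at this
  rw [hu, smul_smul, mul_inv_cancel₀ hpos.ne', one_smul, add_sub_cancel] at this
  linarith

end SurvivalData

/-! ### The grid and the grouped data -/

theorem sum_grid {τ ζ : ℝ} (hτ : 0 < τ) {m : ℕ} (hm : ζ = m * τ) (f : ℝ → ℝ) :
    ∑ t ∈ grid τ ζ, f t = ∑ k ∈ Finset.range m, f (((k + 1 : ℕ) : ℝ) * τ) := by
  have hfl : ⌊ζ / τ⌋₊ = m := by rw [hm, mul_div_cancel_right₀ _ hτ.ne', Nat.floor_natCast]
  unfold grid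
  rw [Finset.sum_image, hfl, Finset.range_eq_Ico,
    Finset.sum_Ico_add' (fun k : ℕ => f (k * τ)) 0 m 1]
  · rfl
  · intro a _ b _ hab
    exact_mod_cast mul_right_cancel₀ hτ.ne' hab

theorem exists_of_mem_grid {τ ζ t : ℝ} (hτ : 0 < τ) (hζ : 0 ≤ ζ) (ht : t ∈ grid τ ζ) :
    ∃ k : ℤ, t = k * τ ∧ 0 ≤ t - τ ∧ t ≤ ζ := by
  simp only [grid, Finset.mem_image, Finset.mem_Icc] at ht
  obtain ⟨k, ⟨hk1, hk2⟩, rfl⟩ := ht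
  refine ⟨k, by simp, ?_, ?_⟩
  · have : (1 : ℝ) ≤ k := by exact_mod_cast hk1
    nlinarith
  · rw [← le_div_iff₀ hτ]
    exact (Nat.le_floor_iff (by positivity)).1 hk2

/-- Within one cell of the grid, comparison with a rounded time does not depend on the point of
the cell. -/
theorem le_roundUp_iff {τ a s : ℝ} (hτ : 0 < τ) {k : ℤ} (hs : s ∈ Ioc (k * τ - τ) (k * τ)) :
    s ≤ roundUp τ a ↔ k * τ - τ < a := by
  have h1 : k * τ - τ < a ↔ k ≤ ⌈a / τ⌉ := by
    rw [show k * τ - τ = ((k - 1 : ℤ) : ℝ) * τ by push_cast; ring, ← lt_div_iff₀ hτ,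
      ← Int.lt_ceil, Int.sub_one_lt_iff]
  rw [h1]
  unfold roundUp
  constructor
  · intro h
    have h2 : ((k - 1 : ℤ) : ℝ) * τ < (⌈a / τ⌉ : ℝ) * τ := by
      push_cast; linarith [hs.1]
    have h3 := lt_of_mul_lt_mul_right h2 hτ.le
    have h4 : k - 1 < ⌈a / τ⌉ := by exact_mod_cast h3
    omega
  · intro h
    have : (k : ℝ) ≤ ⌈a / τ⌉ := by exact_mod_cast h
    nlinarith [hs.2]

theorem roundUp_le_iff {τ a : ℝ} (hτ : 0 < τ) {k : ℤ} : roundUp τ a ≤ k * τ ↔ a ≤ k * τ := by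
  unfold roundUp
  rw [mul_comm, mul_le_mul_iff_left₀ hτ, Int.cast_le, Int.ceil_le, div_le_iff₀ hτ]

section GroupedData

variable {d : ℕ} {x : ℕ → EuclideanSpace ℝ (Fin d)} {T C : ℕ → ℝ} {τ ζ t : ℝ} {n : ℕ}

/-- On the grid, the risk set consists of the subjects whose underlying event and censoring times
exceed the previous grid point, and it is constant between grid points. -/
theorem mem_atRisk_groupedData_iff (hτ : 0 < τ) (hζ : 0 ≤ ζ) (ht : t ∈ grid τ ζ) {s : ℝ}
    (hs : s ∈ Ioc (t - τ) t) (i : Fin n) :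
    i ∈ (groupedData x T C τ n).atRisk s ↔ t - τ < T i ∧ t - τ < C i := by
  obtain ⟨k, rfl, -⟩ := exists_of_mem_grid hτ hζ ht
  rw [SurvivalData.mem_atRisk]
  simp only [groupedData, le_min_iff, le_roundUp_iff hτ hs]

theorem mem_events_groupedData_iff (hτ : 0 < τ) (hζ : 0 ≤ ζ) (ht : t ∈ grid τ ζ) (i : Fin n) :
    i ∈ (groupedData x T C τ n).events t ↔ T i ∈ Ioc (t - τ) t ∧ t - τ < C i := by
  obtain ⟨k, rfl, -⟩ := exists_of_mem_grid hτ hζ ht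
  have hs : (k * τ : ℝ) ∈ Ioc (k * τ - τ) (k * τ) := ⟨by linarith, le_rfl⟩
  rw [mem_Ioc, ← le_roundUp_iff hτ hs, ← le_roundUp_iff hτ hs, ← roundUp_le_iff hτ,
    SurvivalData.mem_events]
  simp only [groupedData]
  constructor
  · rintro ⟨h1, h2⟩
    rw [min_eq_left h2] at h1
    exact ⟨⟨h1.ge, h1.le⟩, h1 ▸ h2⟩
  · rintro ⟨⟨h1, h2⟩, h3⟩
    have h4 := le_antisymm h2 h1
    exact ⟨by rw [h4, min_eq_left h3], by rwa [h4]⟩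

theorem atRisk_groupedData_eq (hτ : 0 < τ) (hζ : 0 ≤ ζ) (ht : t ∈ grid τ ζ) {s : ℝ}
    (hs : s ∈ Ioc (t - τ) t) :
    (groupedData x T C τ n).atRisk s = (groupedData x T C τ n).atRisk t := by
  ext i
  rw [mem_atRisk_groupedData_iff hτ hζ ht hs,
    mem_atRisk_groupedData_iff hτ hζ ht ⟨by linarith, le_rfl⟩]

/-- The indicators of the cells `(t - τ, t]` of the grid add up to at most one. -/
theorem sum_grid_indicator_le (hτ : 0 < τ) (hζ : 0 ≤ ζ) (a : ℝ) :
    ∑ t ∈ grid τ ζ, (Ioc (t - τ) t).indicator (fun _ => (1 : ℝ)) a ≤ 1 := by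
  classical
  calc _ ≤ ∑ t ∈ grid τ ζ, if t = roundUp τ a then (1 : ℝ) else 0 := by
        refine Finset.sum_le_sum fun t ht => ?_
        by_cases h : a ∈ Ioc (t - τ) t
        · obtain ⟨k, rfl, -⟩ := exists_of_mem_grid hτ hζ ht
          have h1 := (roundUp_le_iff hτ).2 h.2
          have h2 := (le_roundUp_iff hτ (s := k * τ) ⟨by linarith, le_rfl⟩).2 h.1
          rw [if_pos (le_antisymm h2 h1)]
          exact indicator_le' (fun _ _ => le_rfl) (fun _ _ => zero_le_one) _
        · rw [indicator_of_notMem h]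
          split_ifs <;> norm_num
    _ ≤ 1 := by
        rw [Finset.sum_ite_eq']
        split_ifs <;> norm_num

end GroupedData

section CumHazard

variable {lam : ℝ → ℝ} {ζ τ : ℝ}

theorem cumHazard_sub (hint : IntervalIntegrable lam volume 0 ζ) {s t : ℝ}
    (hs : s ∈ Icc 0 ζ) (ht : t ∈ Icc 0 ζ) :
    cumHazard lam t - cumHazard lam s = ∫ u in s..t, lam u := by
  unfold cumHazard
  have h : ∀ r ∈ Icc 0 ζ, IntervalIntegrable lam volume 0 r := fun r hr =>
    hint.mono_set (by
      rw [uIcc_of_le hr.1, uIcc_of_le (hr.1.trans hr.2)]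
      exact Icc_subset_Icc le_rfl hr.2)
  exact intervalIntegral.integral_interval_sub_left (h t ht) (h s hs)

theorem cumHazard_mono (hint : IntervalIntegrable lam volume 0 ζ) (hlam : ∀ t, 0 ≤ lam t) {s t : ℝ}
    (hs : s ∈ Icc 0 ζ) (ht : t ∈ Icc 0 ζ) (hst : s ≤ t) : cumHazard lam s ≤ cumHazard lam t := by
  rw [← sub_nonneg, cumHazard_sub hint hs ht]
  exact intervalIntegral.integral_nonneg hst fun u _ => hlam u

theorem sum_grid_cumHazard (hτ : 0 < τ) {m : ℕ} (hm : ζ = m * τ) :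
    ∑ t ∈ grid τ ζ, (cumHazard lam t - cumHazard lam (t - τ)) = cumHazard lam ζ := by
  rw [sum_grid hτ hm]
  have : ∀ k ∈ Finset.range m, cumHazard lam (((k + 1 : ℕ) : ℝ) * τ) -
      cumHazard lam (((k + 1 : ℕ) : ℝ) * τ - τ) =
      (fun k : ℕ => cumHazard lam (k * τ)) (k + 1) - (fun k : ℕ => cumHazard lam (k * τ)) k := by
    intro k _
    simp only
    congr 2
    push_cast; ring
  rw [Finset.sum_congr rfl this, Finset.sum_range_sub (fun k : ℕ => cumHazard lam (k * τ)), hm]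
  simp [cumHazard]

/-- An integral over `[0, ζ]` is close to a sum over the grid if the integrand is close to a
function that is constant on each cell. -/
theorem abs_sum_grid_sub_integral_le (hint : IntervalIntegrable lam volume 0 ζ)
    (hlam : ∀ t, 0 ≤ lam t) (hτ : 0 < τ) (hζ : 0 ≤ ζ) {m : ℕ} (hm : ζ = m * τ) {g φ : ℝ → ℝ} {ε : ℝ}
    (hφ : IntervalIntegrable (fun s => φ s * lam s) volume 0 ζ)
    (h : ∀ t ∈ grid τ ζ, ∀ s ∈ Ioc (t - τ) t, |g t - φ s| ≤ ε) :
    |∑ t ∈ grid τ ζ, g t * (cumHazard lam t - cumHazard lam (t - τ)) -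
      ∫ s in (0 : ℝ)..ζ, φ s * lam s| ≤ ε * cumHazard lam ζ := by
  have hsum : ∑ t ∈ grid τ ζ, ∫ s in (t - τ)..t, φ s * lam s = ∫ s in (0 : ℝ)..ζ, φ s * lam s := by
    rw [sum_grid hτ hm]
    have h1 := intervalIntegral.sum_integral_adjacent_intervals (μ := volume)
      (f := fun s => φ s * lam s) (a := fun k : ℕ => (k : ℝ) * τ) (n := m) (by
        intro k hk
        refine hφ.mono_set ?_
        rw [uIcc_of_le hζ, uIcc_of_le (by push_cast; nlinarith)]
        refine Icc_subset_Icc (by positivity) ?_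
        rw [hm]
        have : ((k + 1 : ℕ) : ℝ) ≤ m := by exact_mod_cast hk
        nlinarith)
    simp only [Nat.cast_zero, zero_mul] at h1
    rw [hm, ← h1]
    refine Finset.sum_congr rfl fun k _ => ?_
    congr 1
    push_cast; ring
  rw [← hsum, ← Finset.sum_sub_distrib, ← sum_grid_cumHazard hτ hm, Finset.mul_sum]
  refine (Finset.abs_sum_le_sum_abs _ _).trans (Finset.sum_le_sum fun t ht => ?_)
  obtain ⟨k, hk, h0, h1⟩ := exists_of_mem_grid hτ hζ ht
  have hsub : uIcc (t - τ) t ⊆ uIcc 0 ζ := by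
    rw [uIcc_of_le hζ, uIcc_of_le (by linarith)]
    exact Icc_subset_Icc h0 h1
  have hi1 := hint.mono_set hsub
  have hi2 := hφ.mono_set hsub
  rw [cumHazard_sub hint ⟨h0, by linarith⟩ ⟨by linarith, h1⟩, ← intervalIntegral.integral_const_mul,
    ← intervalIntegral.integral_const_mul, ← intervalIntegral.integral_sub (hi1.const_mul _) hi2]
  rw [← Real.norm_eq_abs]
  refine intervalIntegral.norm_integral_le_of_norm_le (by linarith) ?_ (hi1.const_mul _)
  refine Eventually.of_forall fun s hs => ?_
  rw [← sub_mul, norm_mul, Real.norm_eq_abs, Real.norm_eq_abs, abs_of_nonneg (hlam s)]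
  exact mul_le_mul_of_nonneg_right (h t ht s hs) (hlam s)

end CumHazard

/-! ### Events of high probability and compensated event indicators -/

section HighProb

variable {Ω : Type*} [MeasurableSpace Ω] {μ : Measure Ω}

/-- `P n` holds with probability tending to one. The exceptional sets need not be measurable. -/
def HighProb (μ : Measure Ω) (P : ℕ → Ω → Prop) : Prop :=
  Tendsto (fun n => μ {ω | ¬ P n ω}) atTop (𝓝 0)

theorem HighProb.mono {P Q : ℕ → Ω → Prop} (hP : HighProb μ P)
    (h : ∀ᶠ n in atTop, ∀ ω, P n ω → Q n ω) : HighProb μ Q :=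
  tendsto_of_tendsto_of_tendsto_of_le_of_le' tendsto_const_nhds hP
    (Eventually.of_forall fun _ => zero_le)
    (h.mono fun _ hn => measure_mono fun ω hω hPω => hω (hn ω hPω))

theorem HighProb.and {P Q : ℕ → Ω → Prop} (hP : HighProb μ P) (hQ : HighProb μ Q) :
    HighProb μ (fun n ω => P n ω ∧ Q n ω) := by
  have h := hP.add hQ
  rw [add_zero] at h
  refine tendsto_of_tendsto_of_tendsto_of_le_of_le tendsto_const_nhds h (fun _ => zero_le)
    fun n => (measure_mono ?_).trans (measure_union_le _ _)
  intro ω hω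
  by_cases hPω : P n ω
  · exact Or.inr fun hQω => hω ⟨hPω, hQω⟩
  · exact Or.inl hPω

theorem HighProb.forall_fintype {ι : Type*} [Fintype ι] {P : ι → ℕ → Ω → Prop}
    (hP : ∀ k, HighProb μ (P k)) : HighProb μ (fun n ω => ∀ k, P k n ω) := by
  have h := tendsto_finsetSum Finset.univ fun k _ => hP k
  rw [Finset.sum_const_zero] at h
  refine tendsto_of_tendsto_of_tendsto_of_le_of_le tendsto_const_nhds h (fun _ => zero_le)
    fun n => (measure_mono ?_).trans (measure_biUnion_finset_le Finset.univ _)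
  intro ω hω
  simpa using hω

theorem HighProb.of_ae {P : ℕ → Ω → Prop} (hP : ∀ n, ∀ᵐ ω ∂μ, P n ω) : HighProb μ P := by
  have : ∀ n, μ {ω | ¬ P n ω} = 0 := fun n => hP n
  simp [HighProb, this]

theorem HighProb.exists [IsProbabilityMeasure μ] {P : ℕ → Ω → Prop} (hP : HighProb μ P) :
    ∀ᶠ n in atTop, ∃ ω, P n ω := by
  filter_upwards [hP.eventually (gt_mem_nhds zero_lt_one)] with n hn
  by_contra! h
  have : {ω | ¬ P n ω} = univ := by ext ω; simp [h ω]
  rw [this, measure_univ] at hn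
  exact lt_irrefl _ hn

theorem highProb_of_le_div {P : ℕ → Ω → Prop} {c : ℝ}
    (h : ∀ᶠ n in atTop, μ {ω | ¬ P n ω} ≤ ENNReal.ofReal (c / n)) : HighProb μ P := by
  have h1 : Tendsto (fun n : ℕ => ENNReal.ofReal (c / n)) atTop (𝓝 0) := by
    rw [← ENNReal.ofReal_zero]
    exact ENNReal.tendsto_ofReal (tendsto_const_div_atTop_nhds_zero_nat c)
  exact tendsto_of_tendsto_of_tendsto_of_le_of_le' tendsto_const_nhds h1
    (Eventually.of_forall fun _ => zero_le) h

theorem tendstoInMeasure_of_highProb {E : Type*} [PseudoMetricSpace E] {f : ℕ → Ω → E} {g : Ω → E}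
    (h : ∀ ε > 0, HighProb μ fun n ω => dist (f n ω) (g ω) < ε) :
    TendstoInMeasure μ f atTop g := by
  rw [tendstoInMeasure_iff_dist]
  intro ε hε
  simpa [HighProb] using h ε hε

/-- Chebyshev's inequality for a sum of pairwise independent variables. -/
theorem measure_abs_sum_sub_ge_le [IsProbabilityMeasure μ] {n : ℕ} {X : Fin n → Ω → ℝ}
    (hX : ∀ i, MemLp (X i) 2 μ) (hind : Pairwise fun i j => IndepFun (X i) (X j) μ) {c : ℝ}
    (hc : 0 < c) :
    μ {ω | c ≤ |∑ i, X i ω - ∑ i, ∫ ω, X i ω ∂μ|} ≤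
      ENNReal.ofReal ((∑ i, ∫ ω, X i ω ^ 2 ∂μ) / c ^ 2) := by
  have h := meas_ge_le_variance_div_sq (memLp_finsetSum' Finset.univ fun i _ => hX i) hc
  have hE : ∫ ω, (∑ i, X i) ω ∂μ = ∑ i, ∫ ω, X i ω ∂μ := by
    simp only [Finset.sum_apply]
    exact integral_finsetSum _ fun i _ => (hX i).integrable (by norm_num)
  rw [hE, IndepFun.variance_sum (fun i _ => hX i) fun i _ j _ hij => hind hij] at h
  simp only [Finset.sum_apply] at h
  refine h.trans (ENNReal.ofReal_le_ofReal ?_)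
  gcongr with i _
  exact variance_le_expectation_sq (hX i).1

end HighProb

theorem one_sub_exp_neg_bounds {y : ℝ} (hy : 0 ≤ y) :
    0 ≤ 1 - Real.exp (-y) ∧ 1 - Real.exp (-y) ≤ y ∧ y - y ^ 2 ≤ 1 - Real.exp (-y) := by
  have h1 := Real.add_one_le_exp (-y)
  have h2 : Real.exp (-y) ≤ 1 := Real.exp_le_one_iff.2 (by linarith)
  have h3 : Real.exp (-y) * (1 + y) ≤ 1 := by
    have := mul_le_mul_of_nonneg_left (Real.add_one_le_exp y) (Real.exp_pos (-y)).le
    rw [← Real.exp_add, neg_add_cancel, Real.exp_zero] at this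
    linarith
  refine ⟨by linarith, by linarith, ?_⟩
  have h4 : Real.exp (-y) ≤ 1 - y + y ^ 2 := by
    have h5 : (1 : ℝ) ≤ (1 - y + y ^ 2) * (1 + y) := by nlinarith [pow_nonneg hy 3]
    exact le_of_mul_le_mul_right (h3.trans h5) (by linarith)
  linarith

section Model

variable {Ω : Type*} [MeasurableSpace Ω] {μ : Measure Ω} {d : ℕ} {ζ : ℝ}
  {β : EuclideanSpace ℝ (Fin d)} {x : ℕ → EuclideanSpace ℝ (Fin d)} {lam : ℝ → ℝ}
  {T C : ℕ → Ω → ℝ}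

/-- The conditional probability of an event of subject `i` in the cell `(t - τ, t]`, given that the
subject is at risk. -/
noncomputable def hazardProb (β : EuclideanSpace ℝ (Fin d)) (x : ℕ → EuclideanSpace ℝ (Fin d))
    (lam : ℝ → ℝ) (τ : ℝ) (i : ℕ) (t : ℝ) : ℝ :=
  1 - Real.exp (-(Real.exp (inner ℝ (x i) β) * (cumHazard lam t - cumHazard lam (t - τ))))

/-- The hazard over `(s, t]` determines the conditional probability of an event there, given
survival up to `s`. -/
theorem IsCoxModel.measureReal_Ioc [IsProbabilityMeasure μ] (hm : IsCoxModel μ ζ β x lam T C)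
    (i : ℕ) {s t : ℝ}
    (hs : s ∈ Icc 0 ζ) (ht : t ∈ Icc 0 ζ) (hst : s ≤ t) :
    μ.real (T i ⁻¹' Ioc s t) = μ.real (T i ⁻¹' Ioi s) *
      (1 - Real.exp (-(Real.exp (inner ℝ (x i) β) * (cumHazard lam t - cumHazard lam s)))) := by
  have h1 : T i ⁻¹' Ioc s t = T i ⁻¹' Ioi s \ T i ⁻¹' Ioi t := by
    ext ω; simp
  rw [h1, measureReal_sdiff (preimage_mono (Ioi_subset_Ioi hst))
    (hm.measurable_T i measurableSet_Ioi)]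
  have h2 : μ.real (T i ⁻¹' Ioi s) = _ := hm.survival i s hs
  have h3 : μ.real (T i ⁻¹' Ioi t) = _ := hm.survival i t ht
  rw [h2, h3, mul_sub, mul_one, ← Real.exp_add]
  congr 2; ring

/-- The contribution of one subject, with event and censoring times `z`, to the martingale
transform of the weights `a`. The weight is summed over events minus their conditional
probabilities `p`. -/
noncomputable def residual (τ ζ : ℝ) (p a : ℝ → ℝ) (z : ℝ × ℝ) : ℝ :=
  ∑ t ∈ grid τ ζ, a t * ((Ioc (t - τ) t ×ˢ Ioi (t - τ)).indicator (fun _ => (1 : ℝ)) z -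
    p t * (Ioi (t - τ) ×ˢ Ioi (t - τ)).indicator (fun _ => (1 : ℝ)) z)

theorem measurable_residual (τ ζ : ℝ) (p a : ℝ → ℝ) : Measurable (residual τ ζ p a) := by
  unfold residual
  refine Finset.measurable_sum _ fun t _ => Measurable.const_mul (Measurable.sub ?_ ?_) _
  · exact measurable_const.indicator (measurableSet_Ioc.prod measurableSet_Ioi)
  · exact (measurable_const.indicator (measurableSet_Ioi.prod measurableSet_Ioi)).const_mul _

theorem abs_residual_le {τ ζ A H : ℝ} (hτ : 0 < τ) (hζ : 0 ≤ ζ) {p a : ℝ → ℝ}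
    (ha : ∀ t ∈ grid τ ζ, |a t| ≤ A) (hA : 0 ≤ A) (hp : ∀ t ∈ grid τ ζ, 0 ≤ p t)
    (hH : ∑ t ∈ grid τ ζ, p t ≤ H)
    (z : ℝ × ℝ) : |residual τ ζ p a z| ≤ A * (1 + H) := by
  have h1 : ∀ t ∈ grid τ ζ,
      |a t * ((Ioc (t - τ) t ×ˢ Ioi (t - τ)).indicator (fun _ => (1 : ℝ)) z -
        p t * (Ioi (t - τ) ×ˢ Ioi (t - τ)).indicator (fun _ => (1 : ℝ)) z)| ≤
      A * ((Ioc (t - τ) t).indicator (fun _ => (1 : ℝ)) z.1 + p t) := by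
    intro t ht
    rw [abs_mul]
    refine mul_le_mul (ha t ht) ?_ (abs_nonneg _) hA
    have h2 : 0 ≤ (Ioc (t - τ) t ×ˢ Ioi (t - τ)).indicator (fun _ => (1 : ℝ)) z :=
      indicator_nonneg (fun _ _ => zero_le_one) _
    have h3 : (Ioc (t - τ) t ×ˢ Ioi (t - τ)).indicator (fun _ => (1 : ℝ)) z ≤
        (Ioc (t - τ) t).indicator (fun _ => (1 : ℝ)) z.1 := by
      by_cases h : z.1 ∈ Ioc (t - τ) t
      · rw [indicator_of_mem h]
        exact indicator_le' (fun _ _ => le_rfl) (fun _ _ => zero_le_one) _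
      · rw [indicator_of_notMem h, indicator_of_notMem fun h' => h (mem_prod.1 h').1]
    have h4 : 0 ≤ (Ioi (t - τ) ×ˢ Ioi (t - τ)).indicator (fun _ => (1 : ℝ)) z :=
      indicator_nonneg (fun _ _ => zero_le_one) _
    have h5 : (Ioi (t - τ) ×ˢ Ioi (t - τ)).indicator (fun _ => (1 : ℝ)) z ≤ 1 :=
      indicator_le' (fun _ _ => le_rfl) (fun _ _ => zero_le_one) _
    have h6 := hp t ht
    have h7 := mul_le_mul_of_nonneg_left h5 h6
    have h8 := mul_nonneg h6 h4
    rw [abs_le]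
    constructor <;> linarith
  refine (Finset.abs_sum_le_sum_abs _ _).trans ((Finset.sum_le_sum h1).trans ?_)
  rw [← Finset.mul_sum, Finset.sum_add_distrib]
  gcongr
  exact sum_grid_indicator_le hτ hζ z.1

theorem IsCoxModel.sum_hazardProb_le {τ W : ℝ} (hm : IsCoxModel μ ζ β x lam T C)
    (hint : IntervalIntegrable lam volume 0 ζ) (hτ : 0 < τ) (hζ : 0 ≤ ζ) {m : ℕ} (hmul : ζ = m * τ)
    (i : ℕ) (hW : Real.exp (inner ℝ (x i) β) ≤ W) :
    ∑ t ∈ grid τ ζ, hazardProb β x lam τ i t ≤ W * cumHazard lam ζ := by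
  rw [← sum_grid_cumHazard hτ hmul, Finset.mul_sum]
  refine Finset.sum_le_sum fun t ht => ?_
  obtain ⟨k, -, h0, h1⟩ := exists_of_mem_grid hτ hζ ht
  have h2 := cumHazard_mono hint hm.hazard_nonneg ⟨h0, by linarith⟩ ⟨by linarith, h1⟩
    (by linarith : t - τ ≤ t)
  have h3 := mul_nonneg (Real.exp_pos (inner ℝ (x i) β)).le (sub_nonneg.2 h2)
  refine (one_sub_exp_neg_bounds h3).2.1.trans ?_
  exact mul_le_mul_of_nonneg_right hW (by linarith)

theorem IsCoxModel.hazardProb_nonneg {τ t : ℝ} (hm : IsCoxModel μ ζ β x lam T C)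
    (hint : IntervalIntegrable lam volume 0 ζ) (hτ : 0 < τ) (hζ : 0 ≤ ζ) (ht : t ∈ grid τ ζ)
    (i : ℕ) : 0 ≤ hazardProb β x lam τ i t := by
  obtain ⟨k, -, h0, h1⟩ := exists_of_mem_grid hτ hζ ht
  have h2 := cumHazard_mono hint hm.hazard_nonneg ⟨h0, by linarith⟩ ⟨by linarith, h1⟩
    (by linarith : t - τ ≤ t)
  exact (one_sub_exp_neg_bounds
    (mul_nonneg (Real.exp_pos (inner ℝ (x i) β)).le (sub_nonneg.2 h2))).1

/-- The compensated event indicators have mean zero. -/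
theorem IsCoxModel.integral_residual [IsProbabilityMeasure μ] {τ : ℝ}
    (hm : IsCoxModel μ ζ β x lam T C)
    (hτ : 0 < τ) (hζ : 0 ≤ ζ) (i : ℕ) (a : ℝ → ℝ) :
    ∫ ω, residual τ ζ (hazardProb β x lam τ i) a (T i ω, C i ω) ∂μ = 0 := by
  have hTm := hm.measurable_T i
  have hCm := hm.measurable_C i
  have hind : IndepFun (T i) (C i) μ :=
    hm.indep.indepFun (i := Sum.inl i) (j := Sum.inr i) (by simp)
  have hpre : ∀ s t : Set ℝ, (fun ω => (s ×ˢ t).indicator (fun _ => (1 : ℝ)) (T i ω, C i ω)) =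
      (T i ⁻¹' s ∩ C i ⁻¹' t).indicator (fun _ => (1 : ℝ)) := by
    classical
    intro s t; ext ω
    simp only [indicator_apply, mem_prod, mem_inter_iff, mem_preimage]
  have hmeas : ∀ s t : Set ℝ, MeasurableSet s → MeasurableSet t →
      MeasurableSet (T i ⁻¹' s ∩ C i ⁻¹' t) := fun s t hs ht => (hTm hs).inter (hCm ht)
  have hI : ∀ s t : Set ℝ, MeasurableSet s → MeasurableSet t →
      Integrable (fun ω => (s ×ˢ t).indicator (fun _ => (1 : ℝ)) (T i ω, C i ω)) μ := by
    intro s t hs ht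
    rw [hpre]
    exact (integrable_const _).indicator (hmeas s t hs ht)
  have hE : ∀ s t : Set ℝ, MeasurableSet s → MeasurableSet t →
      ∫ ω, (s ×ˢ t).indicator (fun _ => (1 : ℝ)) (T i ω, C i ω) ∂μ =
        μ.real (T i ⁻¹' s) * μ.real (C i ⁻¹' t) := by
    intro s t hs ht
    rw [hpre, integral_indicator_const _ (hmeas s t hs ht), smul_eq_mul, mul_one]
    unfold Measure.real
    rw [hind.measure_inter_preimage_eq_mul s t hs ht, ENNReal.toReal_mul]
  unfold residual
  rw [integral_finsetSum]
  · refine Finset.sum_eq_zero fun t ht => ?_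
    obtain ⟨k, -, h0, h1⟩ := exists_of_mem_grid hτ hζ ht
    rw [integral_const_mul, integral_sub (hI _ _ measurableSet_Ioc measurableSet_Ioi)
      ((hI _ _ measurableSet_Ioi measurableSet_Ioi).const_mul _), integral_const_mul,
      hE _ _ measurableSet_Ioc measurableSet_Ioi, hE _ _ measurableSet_Ioi measurableSet_Ioi,
      hm.measureReal_Ioc i ⟨h0, by linarith⟩ ⟨by linarith, h1⟩ (by linarith)]
    unfold hazardProb
    ring
  · intro t _
    exact ((hI _ _ measurableSet_Ioc measurableSet_Ioi).sub
      ((hI _ _ measurableSet_Ioi measurableSet_Ioi).const_mul _)).const_mul _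

/-- A law of large numbers with an explicit rate for weighted sums over events. -/
theorem IsCoxModel.measure_abs_sum_residual_ge_le [IsProbabilityMeasure μ] {τ W A ε : ℝ}
    (hm : IsCoxModel μ ζ β x lam T C)
    (hint : IntervalIntegrable lam volume 0 ζ) (hτ : 0 < τ) (hζ : 0 ≤ ζ) {m : ℕ} (hmul : ζ = m * τ)
    (hW : ∀ i, Real.exp (inner ℝ (x i) β) ≤ W) (hA : 0 ≤ A) {n : ℕ} (hn : 0 < n)
    {a : Fin n → ℝ → ℝ} (ha : ∀ i, ∀ t ∈ grid τ ζ, |a i t| ≤ A) (hε : 0 < ε) :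
    μ {ω | ε * n ≤ |∑ i : Fin n, residual τ ζ (hazardProb β x lam τ i) (a i) (T i ω, C i ω)|} ≤
      ENNReal.ofReal (((A * (1 + W * cumHazard lam ζ)) ^ 2 / ε ^ 2) / n) := by
  have hn' : (0 : ℝ) < n := by exact_mod_cast hn
  have hTC : ∀ i, Measurable fun ω => (T i ω, C i ω) := fun i =>
    (hm.measurable_T i).prodMk (hm.measurable_C i)
  have hbd : ∀ (i : Fin n) ω,
      |residual τ ζ (hazardProb β x lam τ i) (a i) (T i ω, C i ω)| ≤
        A * (1 + W * cumHazard lam ζ) := fun i ω =>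
    abs_residual_le hτ hζ (ha i) hA (fun t ht => hm.hazardProb_nonneg hint hτ hζ ht i)
      (hm.sum_hazardProb_le hint hτ hζ hmul i (hW i)) _
  have hL : ∀ i : Fin n,
      MemLp (fun ω => residual τ ζ (hazardProb β x lam τ i) (a i) (T i ω, C i ω)) 2 μ := fun i =>
    MemLp.of_bound ((measurable_residual _ _ _ _).comp (hTC i)).aestronglyMeasurable _
      (Eventually.of_forall fun ω => hbd i ω)
  have hind : Pairwise fun i j : Fin n => IndepFun
      (fun ω => residual τ ζ (hazardProb β x lam τ i) (a i) (T i ω, C i ω))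
      (fun ω => residual τ ζ (hazardProb β x lam τ j) (a j) (T j ω, C j ω)) μ := by
    intro i j hij
    have hij' : (i : ℕ) ≠ j := fun h => hij (Fin.ext h)
    have h := hm.indep.indepFun_prodMk_prodMk (fun k => by
        cases k
        · exact hm.measurable_T _
        · exact hm.measurable_C _)
      (Sum.inl (i : ℕ)) (Sum.inr (i : ℕ)) (Sum.inl (j : ℕ)) (Sum.inr (j : ℕ))
      (by simpa using hij') (by simp) (by simp) (by simpa using hij')
    exact h.comp (measurable_residual _ _ _ _) (measurable_residual _ _ _ _)
  have h := measure_abs_sum_sub_ge_le hL hind (mul_pos hε hn')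
  simp only [hm.integral_residual hτ hζ, Finset.sum_const_zero, sub_zero] at h
  refine h.trans (ENNReal.ofReal_le_ofReal ?_)
  have h2 : ∑ i : Fin n, ∫ ω, residual τ ζ (hazardProb β x lam τ i) (a i) (T i ω, C i ω) ^ 2 ∂μ ≤
      n * (A * (1 + W * cumHazard lam ζ)) ^ 2 := by
    have h3 : ∀ i : Fin n,
        ∫ ω, residual τ ζ (hazardProb β x lam τ i) (a i) (T i ω, C i ω) ^ 2 ∂μ ≤
          (A * (1 + W * cumHazard lam ζ)) ^ 2 := by
      intro i
      have h4 := integral_mono (μ := μ) (hL i).integrable_sq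
        (integrable_const ((A * (1 + W * cumHazard lam ζ)) ^ 2)) fun ω => by
          simpa [sq_abs] using pow_le_pow_left₀ (abs_nonneg _) (hbd i ω) 2
      simpa using h4
    simpa using Finset.sum_le_sum fun i (_ : i ∈ Finset.univ) => h3 i
  calc _ ≤ n * (A * (1 + W * cumHazard lam ζ)) ^ 2 / (ε * n) ^ 2 := by gcongr
    _ = _ := by field_simp

/-- Summed over the subjects, the residuals are the weighted sum over events minus its
compensator. -/
theorem sum_residual_eq {τ : ℝ} (hτ : 0 < τ) (hζ : 0 ≤ ζ) {n : ℕ} (p a : Fin n → ℝ → ℝ)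
    (S U : ℕ → ℝ) :
    ∑ i : Fin n, residual τ ζ (p i) (a i) (S i, U i) =
      ∑ t ∈ grid τ ζ, (∑ i ∈ (groupedData x S U τ n).events t, a i t -
        ∑ i ∈ (groupedData x S U τ n).atRisk t, a i t * p i t) := by
  classical
  unfold residual
  rw [Finset.sum_comm]
  refine Finset.sum_congr rfl fun t ht => ?_
  have key : ∀ (s : Finset (Fin n)) (f : Fin n → ℝ), ∑ i ∈ s, f i =
      ∑ i, if i ∈ s then f i else 0 := fun s f => by simp
  rw [key (SurvivalData.events _ t), key (SurvivalData.atRisk _ t), ← Finset.sum_sub_distrib]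
  refine Finset.sum_congr rfl fun i _ => ?_
  have h0 : t - τ < t := by linarith
  simp only [mem_events_groupedData_iff hτ hζ ht,
    mem_atRisk_groupedData_iff hτ hζ ht ⟨h0, le_rfl⟩, indicator_apply, mem_prod, mem_Ioi]
  split_ifs <;> ring

end Model

/-! ### Laws of large numbers for grouped events -/

section Model

variable {Ω : Type*} [MeasurableSpace Ω] {μ : Measure Ω} {d : ℕ} {ζ : ℝ}
  {β : EuclideanSpace ℝ (Fin d)} {x : ℕ → EuclideanSpace ℝ (Fin d)} {lam : ℝ → ℝ}
  {T C : ℕ → Ω → ℝ}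

/-- The grouped data of the first `n` subjects at the sample point `ω`. -/
noncomputable abbrev sampleData (x : ℕ → EuclideanSpace ℝ (Fin d)) (T C : ℕ → Ω → ℝ) (τ : ℕ → ℝ)
    (n : ℕ) (ω : Ω) : SurvivalData d n :=
  groupedData x (fun i => T i ω) (fun i => C i ω) (τ n) n

/-- The Cox model together with a sequence of grids that becomes fine, for which the increments of
the cumulative hazard are of the order of the mesh. The relative risks at `β` are bounded
by `W`. -/
structure IsGroupedCoxModel (μ : Measure Ω) (ζ : ℝ) (β : EuclideanSpace ℝ (Fin d))
    (x : ℕ → EuclideanSpace ℝ (Fin d)) (lam : ℝ → ℝ) (T C : ℕ → Ω → ℝ) (τ : ℕ → ℝ) (W K : ℝ) :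
    Prop where
  model : IsCoxModel μ ζ β x lam T C
  integrable : IntervalIntegrable lam volume 0 ζ
  mesh_pos : ∀ n, 0 < τ n
  length_nonneg : 0 ≤ ζ
  exists_mul : ∀ n, ∃ m : ℕ, ζ = m * τ n
  mesh_tendsto : Tendsto τ atTop (𝓝 0)
  jump_le : ∀ᶠ n in atTop, ∀ t ∈ grid (τ n) ζ,
    cumHazard lam t - cumHazard lam (t - τ n) ≤ K * τ n
  risk_le : ∀ i, Real.exp (inner ℝ (x i) β) ≤ W

/-- A law of large numbers for weighted sums over events: the number of events in a cell of the
grid may be replaced by the increment of the cumulative hazard times the relative risks of the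
subjects at risk. -/
theorem IsGroupedCoxModel.highProb_sum_events [IsProbabilityMeasure μ] {τ : ℕ → ℝ} {W A K : ℝ}
    (h : IsGroupedCoxModel μ ζ β x lam T C τ W K) (hA : 0 ≤ A)
    (a : (n : ℕ) → Fin n → ℝ → ℝ) (ha : ∀ n i, ∀ t ∈ grid (τ n) ζ, |a n i t| ≤ A)
    {ε : ℝ} (hε : 0 < ε) :
    HighProb μ fun n ω =>
      |∑ t ∈ grid (τ n) ζ,
        (∑ i ∈ (sampleData x T C τ n ω).events t, a n i t -
          (cumHazard lam t - cumHazard lam (t - τ n)) *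
          ∑ i ∈ (sampleData x T C τ n ω).atRisk t,
            a n i t * Real.exp (inner ℝ (x i) β))| ≤ ε * n := by
  obtain ⟨hm, hint, hτ, hζ, hmul, hτ0, hjump, hW⟩ := h
  classical
  have hsmall : ∀ᶠ n in atTop, A * W ^ 2 * (K * τ n) * cumHazard lam ζ ≤ ε / 2 := by
    have : Tendsto (fun n => A * W ^ 2 * (K * τ n) * cumHazard lam ζ) atTop
        (𝓝 (A * W ^ 2 * (K * 0) * cumHazard lam ζ)) :=
      ((hτ0.const_mul K).const_mul _).mul_const _
    simp only [mul_zero, zero_mul] at this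
    exact (this.eventually (gt_mem_nhds (half_pos hε))).mono fun n hn => hn.le
  have hmain : HighProb μ fun n ω => |∑ i : Fin n,
      residual (τ n) ζ (hazardProb β x lam (τ n) i) (a n i) (T i ω, C i ω)| < ε / 2 * n := by
    refine highProb_of_le_div (c := (A * (1 + W * cumHazard lam ζ)) ^ 2 / (ε / 2) ^ 2) ?_
    filter_upwards [eventually_gt_atTop 0] with n hn
    obtain ⟨m, hmn⟩ := hmul n
    simpa only [not_lt] using
      hm.measure_abs_sum_residual_ge_le hint (hτ n) hζ hmn hW hA hn (ha n) (half_pos hε)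
  refine hmain.mono ?_
  filter_upwards [hsmall, hjump] with n hn1 hn2 ω hω
  obtain ⟨m, hmn⟩ := hmul n
  set D := sampleData x T C τ n ω with hD
  rw [sum_residual_eq (x := x) (hτ n) hζ (fun i => hazardProb β x lam (τ n) i) (a n)
    (fun i => T i ω) (fun i => C i ω)] at hω
  change |∑ t ∈ grid (τ n) ζ, (∑ i ∈ D.events t, _ - ∑ i ∈ D.atRisk t, _)| < _ at hω
  -- the probability of an event of a subject at risk is linear in the hazard up to second order
  have hdiff : ∀ t ∈ grid (τ n) ζ, |(∑ i ∈ D.atRisk t, a n i t * hazardProb β x lam (τ n) i t) -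
      (cumHazard lam t - cumHazard lam (t - τ n)) *
        ∑ i ∈ D.atRisk t, a n i t * Real.exp (inner ℝ (x i) β)| ≤
      A * W ^ 2 * (K * τ n) * n * (cumHazard lam t - cumHazard lam (t - τ n)) := by
    intro t ht
    obtain ⟨k, -, h0, h1⟩ := exists_of_mem_grid (hτ n) hζ ht
    have hτn := hτ n
    have h2 := sub_nonneg.2 (cumHazard_mono hint hm.hazard_nonneg ⟨h0, by linarith⟩
      ⟨by linarith, h1⟩ (by linarith : t - τ n ≤ t))
    have h3 := hn2 t ht
    set L := cumHazard lam t - cumHazard lam (t - τ n) with hL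
    rw [Finset.mul_sum, ← Finset.sum_sub_distrib]
    have h4 : ∀ i ∈ D.atRisk t, |a n i t * hazardProb β x lam (τ n) i t -
        L * (a n i t * Real.exp (inner ℝ (x i) β))| ≤ A * W ^ 2 * (K * τ n) * L := by
      intro i _
      set θ := Real.exp (inner ℝ (x i) β) with hθ
      have hθ0 : 0 < θ := Real.exp_pos _
      have hb := one_sub_exp_neg_bounds (y := θ * L) (by positivity)
      have h5 : |hazardProb β x lam (τ n) i t - θ * L| ≤ W ^ 2 * (K * τ n) * L := by
        have h6 : (θ * L) ^ 2 ≤ W ^ 2 * (K * τ n) * L := by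
          calc _ = θ ^ 2 * L * L := by ring
            _ ≤ W ^ 2 * (K * τ n) * L := by
              have := hW i
              gcongr
        change |1 - Real.exp (-(θ * L)) - θ * L| ≤ _
        rw [abs_le]; constructor <;> linarith [hb.2.1, hb.2.2, sq_nonneg (θ * L)]
      calc _ = |a n i t| * |hazardProb β x lam (τ n) i t - θ * L| := by
            rw [← abs_mul]; congr 1; ring
        _ ≤ A * (W ^ 2 * (K * τ n) * L) := mul_le_mul (ha n i t ht) h5 (abs_nonneg _) hA
        _ = _ := by ring
    refine (Finset.abs_sum_le_sum_abs _ _).trans ((Finset.sum_le_sum h4).trans ?_)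
    rw [Finset.sum_const, nsmul_eq_mul]
    have h7 : ((D.atRisk t).card : ℝ) ≤ n := by
      exact_mod_cast (Finset.card_le_univ _).trans_eq (Fintype.card_fin n)
    have h8 : 0 ≤ A * W ^ 2 * (K * τ n) * L := by
      have : 0 ≤ K * τ n := h2.trans h3
      positivity
    calc _ ≤ (n : ℝ) * (A * W ^ 2 * (K * τ n) * L) := mul_le_mul_of_nonneg_right h7 h8
      _ = _ := by ring
  have hdiff' : |∑ t ∈ grid (τ n) ζ,
      ((∑ i ∈ D.atRisk t, a n i t * hazardProb β x lam (τ n) i t) -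
      (cumHazard lam t - cumHazard lam (t - τ n)) *
        ∑ i ∈ D.atRisk t, a n i t * Real.exp (inner ℝ (x i) β))| ≤ ε / 2 * n := by
    refine (Finset.abs_sum_le_sum_abs _ _).trans ((Finset.sum_le_sum hdiff).trans ?_)
    rw [← Finset.mul_sum, sum_grid_cumHazard (hτ n) hmn]
    nlinarith [(Nat.cast_nonneg n : (0 : ℝ) ≤ n)]
  have h := (abs_add_le _ _).trans (add_le_add hω.le hdiff')
  rw [← Finset.sum_add_distrib] at h
  simp only [sub_add_sub_cancel] at h
  linarith

/-- No cell of the grid contains a positive fraction of the events. -/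
theorem IsGroupedCoxModel.highProb_card_events_le [IsProbabilityMeasure μ] {τ : ℕ → ℝ} {W K : ℝ}
    (h : IsGroupedCoxModel μ ζ β x lam T C τ W K)
    {ε : ℝ} (hε : 0 < ε) :
    HighProb μ fun n ω => ∀ t ∈ grid (τ n) ζ,
      (((sampleData x T C τ n ω).events t).card : ℝ) ≤ ε * n := by
  obtain ⟨hm, hint, hτ, hζ, hmul, hτ0, hjump, hW⟩ := h
  classical
  have hsmall : ∀ᶠ n in atTop, W * (K * τ n) ≤ ε / 2 := by
    have : Tendsto (fun n => W * (K * τ n)) atTop (𝓝 (W * (K * 0))) :=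
      (hτ0.const_mul K).const_mul _
    simp only [mul_zero] at this
    exact (this.eventually (gt_mem_nhds (half_pos hε))).mono fun n hn => hn.le
  refine highProb_of_le_div (c := W * cumHazard lam ζ / (ε / 2) ^ 2) ?_
  filter_upwards [hsmall, hjump, eventually_gt_atTop 0] with n hn1 hn2 hn
  obtain ⟨m, hmn⟩ := hmul n
  have hn' : (0 : ℝ) < n := by exact_mod_cast hn
  have hW0 : 0 ≤ W := (Real.exp_pos _).le.trans (hW 0)
  have hτn := hτ n
  have hcell : ∀ t ∈ grid (τ n) ζ, 0 ≤ cumHazard lam t - cumHazard lam (t - τ n) ∧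
      ∀ i, μ.real (T i ⁻¹' Ioc (t - τ n) t) ≤
        W * (cumHazard lam t - cumHazard lam (t - τ n)) := by
    intro t ht
    obtain ⟨k, -, h0, h1⟩ := exists_of_mem_grid (hτ n) hζ ht
    have h2 := sub_nonneg.2 (cumHazard_mono hint hm.hazard_nonneg ⟨h0, by linarith⟩
      ⟨by linarith, h1⟩ (by linarith : t - τ n ≤ t))
    refine ⟨h2, fun i => ?_⟩
    rw [hm.measureReal_Ioc i ⟨h0, by linarith⟩ ⟨by linarith, h1⟩ (by linarith)]
    have hb := one_sub_exp_neg_bounds (mul_nonneg (Real.exp_pos (inner ℝ (x i) β)).le h2)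
    calc _ ≤ 1 * (W * (cumHazard lam t - cumHazard lam (t - τ n))) :=
          mul_le_mul measureReal_le_one
            (hb.2.1.trans (mul_le_mul_of_nonneg_right (hW i) h2)) hb.1 zero_le_one
      _ = _ := one_mul _
  have hone : ∀ t ∈ grid (τ n) ζ,
      μ {ω | ε * n < (((sampleData x T C τ n ω).events t).card : ℝ)}
        ≤ ENNReal.ofReal (W * (cumHazard lam t - cumHazard lam (t - τ n)) /
          ((ε / 2) ^ 2 * n)) := by
    intro t ht
    set X : Fin n → Ω → ℝ := fun i => (T i ⁻¹' Ioc (t - τ n) t).indicator fun _ => 1 with hX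
    have hms : ∀ i, MeasurableSet (T i ⁻¹' Ioc (t - τ n) t) := fun i =>
      hm.measurable_T i measurableSet_Ioc
    have hL : ∀ i, MemLp (X i) 2 μ := fun i => memLp_indicator_const 2 (hms i) 1 (by simp)
    have hEX : ∀ i : Fin n, ∫ ω, X i ω ∂μ = μ.real (T i ⁻¹' Ioc (t - τ n) t) := fun i => by
      rw [hX, integral_indicator_const _ (hms i), smul_eq_mul, mul_one]
    have hEX2 : ∀ i : Fin n, ∫ ω, X i ω ^ 2 ∂μ = μ.real (T i ⁻¹' Ioc (t - τ n) t) := fun i => by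
      rw [← hEX]
      congr 1; ext ω
      simp only [hX, indicator_apply]
      split_ifs <;> norm_num
    have hind : Pairwise fun i j => IndepFun (X i) (X j) μ := by
      intro i j hij
      have h := hm.indep.indepFun (i := Sum.inl (i : ℕ)) (j := Sum.inl (j : ℕ))
        (by simpa using fun h => hij (Fin.ext h))
      exact h.comp (φ := (Ioc (t - τ n) t).indicator fun _ => (1 : ℝ))
        (ψ := (Ioc (t - τ n) t).indicator fun _ => (1 : ℝ))
        (measurable_const.indicator measurableSet_Ioc)
        (measurable_const.indicator measurableSet_Ioc)
    have h := measure_abs_sum_sub_ge_le hL hind (c := ε / 2 * n) (by positivity)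
    have hsum : ∑ i : Fin n, μ.real (T i ⁻¹' Ioc (t - τ n) t) ≤
        n * (W * (cumHazard lam t - cumHazard lam (t - τ n))) := by
      simpa using Finset.sum_le_sum fun (i : Fin n) (_ : i ∈ Finset.univ) => (hcell t ht).2 i
    refine (measure_mono ?_).trans (h.trans (ENNReal.ofReal_le_ofReal ?_))
    · intro ω hω
      simp only [mem_ofPred_eq, hEX] at hω ⊢
      have h1 : (((sampleData x T C τ n ω).events t).card : ℝ) ≤
          ∑ i, X i ω := by
        rw [Finset.card_eq_sum_ones, Nat.cast_sum]
        calc _ ≤ ∑ i ∈ (sampleData x T C τ n ω).events t, X i ω := by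
              refine Finset.sum_le_sum fun i hi => ?_
              rw [mem_events_groupedData_iff (hτ n) hζ ht] at hi
              simp only [hX]
              rw [indicator_of_mem (mem_preimage.2 hi.1)]; simp
          _ ≤ _ := Finset.sum_le_sum_of_subset_of_nonneg (Finset.subset_univ _) fun i _ _ =>
              indicator_nonneg (fun _ _ => zero_le_one) _
      have h2 := hn2 t ht
      have h3 : (n : ℝ) * (W * (cumHazard lam t - cumHazard lam (t - τ n))) ≤ ε / 2 * n := by
        have := mul_le_mul_of_nonneg_left h2 hW0
        nlinarith
      refine le_trans ?_ (le_abs_self _)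
      linarith
    · simp only [hEX2]
      calc _ ≤ n * (W * (cumHazard lam t - cumHazard lam (t - τ n))) / (ε / 2 * n) ^ 2 := by
            gcongr
        _ = _ := by field_simp
  have hset : {ω | ¬ ∀ t ∈ grid (τ n) ζ, (((sampleData x T C τ n ω).events t).card : ℝ) ≤ ε * n} ⊆
      ⋃ t ∈ grid (τ n) ζ, {ω | ε * n <
      (((sampleData x T C τ n ω).events t).card : ℝ)} := by
    intro ω hω
    simpa using hω
  refine (measure_mono hset).trans ((measure_biUnion_finset_le _ _).trans
    ((Finset.sum_le_sum hone).trans ?_))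
  rw [← ENNReal.ofReal_sum_of_nonneg fun t ht => by
    have := (hcell t ht).1
    positivity, ← Finset.sum_div, ← Finset.mul_sum, sum_grid_cumHazard (hτ n) hmn, div_div]

end Model

/-! ### Limits of the moments of the covariates -/

/-- Ratios, covariances and scaled covariances depend uniformly continuously on the moments, as
long as the total weight stays away from `0` and all moments are bounded. -/
theorem exists_moment_modulus {m K η : ℝ} (hm : 0 < m) (hη : 0 < η) :
    ∃ δ > 0, ∀ s a b c s' a' b' c' : ℝ, m ≤ s → m ≤ s' → |s| ≤ K → |s'| ≤ K → |a| ≤ K → |a'| ≤ K →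
      |b| ≤ K → |b'| ≤ K → |c| ≤ K → |c'| ≤ K →
      |s - s'| ≤ δ → |a - a'| ≤ δ → |b - b'| ≤ δ → |c - c'| ≤ δ →
      |a / s - a' / s'| ≤ η ∧ |(c / s - a / s * (b / s)) - (c' / s' - a' / s' * (b' / s'))| ≤ η ∧
      |(c / s - a / s * (b / s)) * s - (c' / s' - a' / s' * (b' / s')) * s'| ≤ η := by
  set S : Set (ℝ × ℝ × ℝ × ℝ) := Icc m K ×ˢ Icc (-K) K ×ˢ Icc (-K) K ×ˢ Icc (-K) K with hS
  have hScomp : IsCompact S :=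
    isCompact_Icc.prod (isCompact_Icc.prod (isCompact_Icc.prod isCompact_Icc))
  set F : ℝ × ℝ × ℝ × ℝ → ℝ × ℝ × ℝ := fun p => (p.2.1 / p.1,
    p.2.2.2 / p.1 - p.2.1 / p.1 * (p.2.2.1 / p.1),
    (p.2.2.2 / p.1 - p.2.1 / p.1 * (p.2.2.1 / p.1)) * p.1) with hF
  have hne : ∀ p ∈ S, p.1 ≠ 0 := fun p hp => (hm.trans_le hp.1.1).ne'
  have hcont : ContinuousOn F S := by
    rw [hF]
    fun_prop (disch := exact hne)
  obtain ⟨δ, hδ, h⟩ := Metric.uniformContinuousOn_iff_le.1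
    (hScomp.uniformContinuousOn_of_continuous hcont) η hη
  refine ⟨δ, hδ, fun s a b c s' a' b' c' hs hs' h1 h2 h3 h4 h5 h6 h7 h8 d1 d2 d3 d4 => ?_⟩
  have := h (s, a, b, c) ⟨⟨hs, (abs_le.1 h1).2⟩, abs_le.1 h3, abs_le.1 h5, abs_le.1 h7⟩
    (s', a', b', c') ⟨⟨hs', (abs_le.1 h2).2⟩, abs_le.1 h4, abs_le.1 h6, abs_le.1 h8⟩
    (by simp only [Prod.dist_eq, Real.dist_eq, max_le_iff]; exact ⟨d1, d2, d3, d4⟩)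
  simp only [hF, Prod.dist_eq, Real.dist_eq, max_le_iff] at this
  exact this

section Stability

variable {Ω : Type*} [MeasurableSpace Ω] {μ : Measure Ω} {d : ℕ} {ζ : ℝ}
  {β : EuclideanSpace ℝ (Fin d)} {lam : ℝ → ℝ} {D : (n : ℕ) → Ω → SurvivalData d n}
  {B : Set (EuclideanSpace ℝ (Fin d))} {s0 : EuclideanSpace ℝ (Fin d) → ℝ → ℝ}
  {s1 : EuclideanSpace ℝ (Fin d) → ℝ → EuclideanSpace ℝ (Fin d)}
  {s2 : EuclideanSpace ℝ (Fin d) → ℝ → Matrix (Fin d) (Fin d) ℝ}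

/-- The normalized moments of the data are uniformly within `δ` of their limits. -/
def SurvivalData.MomentsClose {n : ℕ} (D : SurvivalData d n) (ζ : ℝ)
    (B : Set (EuclideanSpace ℝ (Fin d))) (s0 : EuclideanSpace ℝ (Fin d) → ℝ → ℝ)
    (s1 : EuclideanSpace ℝ (Fin d) → ℝ → EuclideanSpace ℝ (Fin d))
    (s2 : EuclideanSpace ℝ (Fin d) → ℝ → Matrix (Fin d) (Fin d) ℝ) (δ : ℝ) : Prop :=
  ∀ b ∈ B, ∀ t ∈ Icc 0 ζ, |D.S0 b t / n - s0 b t| ≤ δ ∧ (∀ k, |D.S1 b t k / n - s1 b t k| ≤ δ) ∧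
    ∀ k l, |D.S2 b t k l / n - s2 b t k l| ≤ δ

theorem TendstoUnifInProb.highProb {F : ℕ → Ω → EuclideanSpace ℝ (Fin d) → ℝ → ℝ}
    {f : EuclideanSpace ℝ (Fin d) → ℝ → ℝ} (h : TendstoUnifInProb μ B ζ F f) {δ : ℝ} (hδ : 0 < δ) :
    HighProb μ fun n ω => ∀ b ∈ B, ∀ t ∈ Icc 0 ζ, |F n ω b t - f b t| ≤ δ := by
  have := h δ hδ
  unfold HighProb
  convert this using 4 with n
  ext ω
  simp [and_assoc]

theorem StabilityConditions.highProb_momentsClose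
    (h : StabilityConditions μ ζ β lam D B s0 s1 s2) {δ : ℝ} (hδ : 0 < δ) :
    HighProb μ fun n ω => (D n ω).MomentsClose ζ B s0 s1 s2 δ := by
  have h0 := h.tendsto_S0.highProb hδ
  have h1 := HighProb.forall_fintype fun k => (h.tendsto_S1 k).highProb hδ
  have h2 := HighProb.forall_fintype fun k => HighProb.forall_fintype fun l =>
    (h.tendsto_S2 k l).highProb hδ
  refine (h0.and (h1.and h2)).mono (Eventually.of_forall fun n ω hω b hb t ht => ?_)
  exact ⟨hω.1 b hb t ht, fun k => hω.2.1 k b hb t ht, fun k l => hω.2.2 k l b hb t ht⟩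

/-- Bounds on the limiting moments that hold simultaneously. -/
theorem StabilityConditions.exists_bounds (h : StabilityConditions μ ζ β lam D B s0 s1 s2) :
    ∃ m K, 0 < m ∧ 0 < K ∧ ∀ b ∈ B, ∀ t ∈ Icc 0 ζ, m ≤ s0 b t ∧ |s0 b t| ≤ K ∧
      (∀ k, |s1 b t k| ≤ K) ∧ (∀ k l, |s2 b t k l| ≤ K) ∧ (∀ k, |s1 b t k / s0 b t| ≤ K / m) ∧
      ∀ k l, |limitV s0 s1 s2 b t k l| ≤ K / m + (K / m) ^ 2 := by
  obtain ⟨m, hm, hlow⟩ := h.lower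
  obtain ⟨K, hK, hup⟩ := h.upper
  refine ⟨m, K, hm, hK, fun b hb t ht => ?_⟩
  obtain ⟨h0, h1, h2⟩ := hup b hb t ht
  have hs := hlow b hb t ht
  have hs0 : 0 < s0 b t := hm.trans hs
  have hratio : ∀ a : ℝ, |a| ≤ K → |a / s0 b t| ≤ K / m := fun a ha => by
    rw [abs_div, abs_of_pos hs0]
    gcongr
  refine ⟨hs.le, h0, h1, h2, fun k => hratio _ (h1 k), fun k l => ?_⟩
  simp only [limitV, Matrix.of_apply]
  refine (abs_sub _ _).trans (add_le_add (hratio _ (h2 k l)) ?_)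
  rw [abs_mul, sq]
  exact mul_le_mul (hratio _ (h1 k)) (hratio _ (h1 l)) (abs_nonneg _) (by positivity)

/-- Closeness of the moments carries over to the weighted means and covariances. -/
theorem StabilityConditions.exists_momentsClose_imp
    (h : StabilityConditions μ ζ β lam D B s0 s1 s2) :
    ∃ m K, 0 < m ∧ 0 < K ∧ ∀ η > 0, ∃ δ > 0, ∀ n : ℕ, 0 < n → ∀ D' : SurvivalData d n,
      D'.MomentsClose ζ B s0 s1 s2 δ → ∀ b ∈ B, ∀ t ∈ Icc 0 ζ,
      m * n ≤ D'.S0 b t ∧ D'.S0 b t ≤ K * n ∧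
      (∀ k, |D'.S1 b t k / D'.S0 b t - s1 b t k / s0 b t| ≤ η) ∧
      (∀ k l, |limitV D'.S0 D'.S1 D'.S2 b t k l - limitV s0 s1 s2 b t k l| ≤ η) ∧
      ∀ k l, |limitV D'.S0 D'.S1 D'.S2 b t k l * (D'.S0 b t / n) -
        limitV s0 s1 s2 b t k l * s0 b t| ≤ η := by
  obtain ⟨m, K, hm, hK, hb⟩ := h.exists_bounds
  refine ⟨m / 2, K + 1, by positivity, by positivity, fun η hη => ?_⟩
  obtain ⟨δ, hδ, hmod⟩ := exists_moment_modulus (m := m / 2) (K := K + 1) (half_pos hm) hη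
  refine ⟨min δ (min (m / 2) 1), by positivity, fun n hn D' hD' b hbB t ht => ?_⟩
  have hn' : (0 : ℝ) < n := by exact_mod_cast hn
  obtain ⟨c0, c1, c2⟩ := hD' b hbB t ht
  obtain ⟨b0, b0', b1, b2, -, -⟩ := hb b hbB t ht
  have le1 : min δ (min (m / 2) 1) ≤ δ := min_le_left _ _
  have le2 : min δ (min (m / 2) 1) ≤ m / 2 := (min_le_right _ _).trans (min_le_left _ _)
  have le3 : min δ (min (m / 2) 1) ≤ 1 := (min_le_right _ _).trans (min_le_right _ _)
  have hlow : m / 2 ≤ D'.S0 b t / n := by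
    have := (abs_le.1 (c0.trans le2)).1
    linarith
  have hup : ∀ A a : ℝ, |A - a| ≤ min δ (min (m / 2) 1) → |a| ≤ K → |A| ≤ K + 1 := by
    intro A a h1 h2
    have := abs_add_le (A - a) a
    rw [sub_add_cancel] at this
    linarith
  have hle : ∀ a : ℝ, |a| ≤ K → |a| ≤ K + 1 := fun a ha => ha.trans (by linarith)
  have key : ∀ k l, _ := fun k l => hmod (D'.S0 b t / n) (D'.S1 b t k / n) (D'.S1 b t l / n)
    (D'.S2 b t k l / n) (s0 b t) (s1 b t k) (s1 b t l) (s2 b t k l) hlow (by linarith)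
    (hup _ _ c0 b0') (hle _ b0') (hup _ _ (c1 k) (b1 k)) (hle _ (b1 k))
    (hup _ _ (c1 l) (b1 l)) (hle _ (b1 l)) (hup _ _ (c2 k l) (b2 k l)) (hle _ (b2 k l))
    (c0.trans le1) ((c1 k).trans le1) ((c1 l).trans le1) ((c2 k l).trans le1)
  simp only [div_div_div_cancel_right₀ hn'.ne'] at key
  refine ⟨(le_div_iff₀ hn').1 hlow, (div_le_iff₀ hn').1 ((le_abs_self _).trans (hup _ _ c0 b0')),
    fun k => (key k k).1, fun k l => (key k l).2.1, fun k l => (key k l).2.2⟩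

/-- The limiting covariance is continuous at `β`, uniformly in time. -/
theorem StabilityConditions.exists_dist_limitV_le
    (h : StabilityConditions μ ζ β lam D B s0 s1 s2) {η : ℝ} (hη : 0 < η) :
    ∃ r > 0, ∀ b, dist b β ≤ r → b ∈ B ∧ ∀ t ∈ Icc 0 ζ, ∀ k l,
      |limitV s0 s1 s2 b t k l - limitV s0 s1 s2 β t k l| ≤ η := by
  obtain ⟨m, K, hm, hK, hb⟩ := h.exists_bounds
  obtain ⟨δ, hδ, hmod⟩ := exists_moment_modulus (m := m) (K := K) hm hη
  have hnhds : 𝓝[B] β = 𝓝 β := h.isOpen.nhdsWithin_eq h.mem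
  have hequi : ∀ f : EuclideanSpace ℝ (Fin d) → ℝ → ℝ,
      EquicontinuousOn (fun (t : Icc (0 : ℝ) ζ) b => f b t) B →
      ∀ᶠ b in 𝓝 β, ∀ t ∈ Icc 0 ζ, |f b t - f β t| ≤ δ := by
    intro f hf
    have := hf β h.mem _ (Metric.dist_mem_uniformity hδ)
    rw [hnhds] at this
    refine this.mono fun b hb t ht => ?_
    have h1 := hb ⟨t, ht⟩
    rw [mem_ofPred_eq, dist_comm, Real.dist_eq] at h1
    exact h1.le
  have e0 := hequi s0 h.cont_s0
  have e1 := eventually_all.2 fun k => hequi (fun b t => s1 b t k) (h.cont_s1 k)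
  have e2 := eventually_all.2 fun k => eventually_all.2 fun l =>
    hequi (fun b t => s2 b t k l) (h.cont_s2 k l)
  have eB : ∀ᶠ b in 𝓝 β, b ∈ B := h.isOpen.mem_nhds h.mem
  obtain ⟨r, hr, hball⟩ := Metric.eventually_nhds_iff.1 (e0.and (e1.and (e2.and eB)))
  refine ⟨r / 2, half_pos hr, fun b hbr => ?_⟩
  obtain ⟨f0, f1, f2, fB⟩ := hball (hbr.trans_lt (half_lt_self hr))
  refine ⟨fB, fun t ht k l => ?_⟩
  obtain ⟨b0, b0', b1, b2, -⟩ := hb b fB t ht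
  obtain ⟨g0, g0', g1, g2, -⟩ := hb β h.mem t ht
  exact (hmod _ _ _ _ _ _ _ _ b0 g0 b0' g0' (b1 k) (g1 k) (b1 l) (g1 l) (b2 k l) (g2 k l)
    (f0 t ht) (f1 k t ht) (f1 l t ht) (f2 k l t ht)).2.1

theorem SurvivalData.measurable_sum_atRisk {n : ℕ} (D : SurvivalData d n) (f : Fin n → ℝ) :
    Measurable fun t => ∑ i ∈ D.atRisk t, f i := by
  classical
  have : ∀ t, ∑ i ∈ D.atRisk t, f i = ∑ i, if t ≤ D.time i then f i else 0 := fun t => by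
    rw [← Finset.sum_filter]
    exact Finset.sum_congr (by ext i; simp [D.mem_atRisk]) fun _ _ => rfl
  simp only [this]
  exact Finset.measurable_sum _ fun i _ => Measurable.ite measurableSet_Iic measurable_const
    measurable_const

/-- The integrand of the limiting information is integrable: it is bounded, and measurable as a
uniform limit of the corresponding step functions of the data. -/
theorem StabilityConditions.intervalIntegrable [IsProbabilityMeasure μ] (hζ : 0 ≤ ζ)
    (h : StabilityConditions μ ζ β lam D B s0 s1 s2) (k l : Fin d) :
    IntervalIntegrable (fun t => limitV s0 s1 s2 β t k l * s0 β t * lam t) volume 0 ζ := by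
  obtain ⟨m, K, hm, hK, hb⟩ := h.exists_bounds
  obtain ⟨_, _, -, -, hclose⟩ := h.exists_momentsClose_imp
  have happrox : ∀ j : ℕ, ∃ ψ : ℝ → ℝ, Measurable ψ ∧ ∀ t ∈ Icc 0 ζ,
      |ψ t - limitV s0 s1 s2 β t k l * s0 β t| ≤ 1 / ((j : ℝ) + 1) := by
    intro j
    obtain ⟨δ, hδ, hδ'⟩ := hclose (1 / ((j : ℝ) + 1)) (by positivity)
    obtain ⟨n, ⟨ω, hω⟩, hn⟩ :=
      ((h.highProb_momentsClose hδ).exists.and (eventually_gt_atTop 0)).exists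
    refine ⟨fun t => limitV (D n ω).S0 (D n ω).S1 (D n ω).S2 β t k l * ((D n ω).S0 β t / n), ?_,
      fun t ht => (hδ' n hn _ hω β h.mem t ht).2.2.2.2 k l⟩
    have m0 : Measurable fun t => (D n ω).S0 β t := (D n ω).measurable_sum_atRisk _
    have m1 : ∀ k, Measurable fun t => (D n ω).S1 β t k := fun k => by
      simpa [SurvivalData.S1] using (D n ω).measurable_sum_atRisk fun i =>
        Real.exp (inner ℝ ((D n ω).x i) β) * (D n ω).x i k
    have m2 : Measurable fun t => (D n ω).S2 β t k l := by
      simpa [SurvivalData.S2, Matrix.sum_apply, Matrix.vecMulVec_apply] using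
        (D n ω).measurable_sum_atRisk fun i =>
          Real.exp (inner ℝ ((D n ω).x i) β) * ((D n ω).x i k * (D n ω).x i l)
    simp only [limitV, Matrix.of_apply]
    exact (((m2.div m0).sub (((m1 k).div m0).mul ((m1 l).div m0)))).mul (m0.div_const _)
  choose ψ hψm hψ using happrox
  have hae : AEStronglyMeasurable (fun t => limitV s0 s1 s2 β t k l * s0 β t)
      (volume.restrict (Ioc 0 ζ)) := by
    refine aestronglyMeasurable_of_tendsto_ae atTop
      (fun j => (hψm j).aestronglyMeasurable) ?_
    refine (ae_restrict_iff' measurableSet_Ioc).2 (Eventually.of_forall fun t ht => ?_)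
    rw [tendsto_iff_dist_tendsto_zero]
    exact squeeze_zero (fun _ => dist_nonneg) (fun j => hψ j t (Ioc_subset_Icc_self ht))
      tendsto_one_div_add_atTop_nhds_zero_nat
  rw [intervalIntegrable_iff_integrableOn_Ioc_of_le hζ]
  refine Integrable.bdd_mul (c := (K / m + (K / m) ^ 2) * K)
    ((intervalIntegrable_iff_integrableOn_Ioc_of_le hζ).1 h.hazard_integrable) hae ?_
  refine (ae_restrict_iff' measurableSet_Ioc).2 (Eventually.of_forall fun t ht => ?_)
  obtain ⟨-, b0, -, -, -, bv⟩ := hb β h.mem t (Ioc_subset_Icc_self ht)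
  rw [norm_mul, Real.norm_eq_abs, Real.norm_eq_abs]
  exact mul_le_mul (bv k l) b0 (abs_nonneg _) (by positivity)

end Stability

/-! ### Asymptotics of score, information and estimator -/

theorem mem_Icc_of_mem_grid {τ ζ t : ℝ} (hτ : 0 < τ) (hζ : 0 ≤ ζ) (ht : t ∈ grid τ ζ) :
    t ∈ Icc 0 ζ := by
  obtain ⟨k, -, h0, h1⟩ := exists_of_mem_grid hτ hζ ht
  exact ⟨by linarith, h1⟩

theorem SurvivalData.score_eq_sum {d n : ℕ} (D : SurvivalData d n) (τ ζ : ℝ)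
    (b u : EuclideanSpace ℝ (Fin d)) :
    D.score τ ζ b u = ∑ k, u k * D.score τ ζ b (EuclideanSpace.single k 1) := by
  obtain ⟨L, -, hL⟩ := D.hasFDerivAt_log_breslowLik τ ζ b
  have hu : u = ∑ k, u k • EuclideanSpace.single k (1 : ℝ) := by
    ext j
    simp [Finset.sum_apply, Pi.single_apply]
  simp only [← hL]
  conv_lhs => rw [hu]
  simp

/-- With probability tending to one the plugged-in jumps are positive at event times and at most of
the order of the number of events divided by `n`. -/
theorem IsPlugIn.highProb {Ω : Type*} [MeasurableSpace Ω] {μ : Measure Ω} {d : ℕ} {ζ : ℝ}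
    {τ : ℕ → ℝ} {D : (n : ℕ) → Ω → SurvivalData d n} {dLam : ℕ → Ω → ℝ → ℝ}
    (h : IsPlugIn μ ζ τ D dLam) :
    ∃ K : ℝ, 0 ≤ K ∧ HighProb μ fun n ω => ∀ t ∈ grid (τ n) ζ, 0 ≤ dLam n ω t ∧
      (((D n ω).events t).card ≠ 0 → 0 < dLam n ω t) ∧
      dLam n ω t * n ≤ K * ((D n ω).events t).card := by
  obtain ⟨nstar, -, hdef, -, K, hK, hinv⟩ := h
  refine ⟨K, K.2, ?_⟩
  have hinv' : HighProb μ fun n ω =>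
      ⨆ t ∈ grid (τ n) ζ, (nstar n ω t : ℝ≥0∞)⁻¹ ≤ K * (n : ℝ≥0∞)⁻¹ := by
    unfold HighProb
    simpa only [not_le] using hinv
  refine (hinv'.and (HighProb.of_ae hdef)).mono ?_
  filter_upwards [eventually_gt_atTop 0] with n hn ω hω t ht
  have hn' : (0 : ℝ) < n := by exact_mod_cast hn
  have h1 : (nstar n ω t : ℝ≥0∞)⁻¹ ≤ K * (n : ℝ≥0∞)⁻¹ := (le_iSup₂ t ht).trans hω.1
  -- a vanishing `n*` would make the left side infinite
  have h2 : nstar n ω t ≠ 0 := by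
    intro h0
    rw [h0, ENNReal.coe_zero, ENNReal.inv_zero, top_le_iff] at h1
    exact ENNReal.mul_ne_top ENNReal.coe_ne_top (by simp [hn.ne']) h1
  have h3 : ((nstar n ω t : ℝ))⁻¹ ≤ K * (n : ℝ)⁻¹ := by
    have h4 := ENNReal.toReal_mono (ENNReal.mul_ne_top ENNReal.coe_ne_top (by simp [hn.ne'])) h1
    simpa using h4
  have h5 : (0 : ℝ) < nstar n ω t := by
    have := pos_iff_ne_zero.2 h2
    exact_mod_cast this
  rw [hω.2 t ht]
  refine ⟨by positivity, fun h0 => ?_, ?_⟩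
  · have : (0 : ℝ) < ((D n ω).events t).card := by exact_mod_cast Nat.pos_of_ne_zero h0
    positivity
  · rw [div_eq_mul_inv, mul_assoc, mul_comm]
    refine mul_le_mul_of_nonneg_right ?_ (by positivity)
    calc _ ≤ K * (n : ℝ)⁻¹ * n := by gcongr
      _ = K := by field_simp

/-- A positive definite matrix is bounded below on the unit sphere. -/
theorem exists_pos_le_of_posDef {d : ℕ} {M : Matrix (Fin d) (Fin d) ℝ} (hM : M.PosDef) :
    ∃ c > 0, ∀ u : EuclideanSpace ℝ (Fin d), ‖u‖ = 1 → c ≤ ∑ k, ∑ l, u k * u l * M k l := by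
  set f : EuclideanSpace ℝ (Fin d) → ℝ := fun u => ∑ k, ∑ l, u k * u l * M k l with hf
  have hcont : Continuous f := by
    rw [hf]; fun_prop
  have hpos : ∀ u : EuclideanSpace ℝ (Fin d), ‖u‖ = 1 → 0 < f u := by
    intro u hu
    have hu0 : (u : Fin d → ℝ) ≠ 0 := by
      intro h0
      have : u = 0 := by ext k; simpa using congrFun h0 k
      simp [this] at hu
    refine (hM.dotProduct_mulVec_pos hu0).trans_eq ?_
    simp only [dotProduct, Matrix.mulVec, Finset.mul_sum, Pi.star_apply, star_trivial, hf]
    refine Finset.sum_congr rfl fun k _ => Finset.sum_congr rfl fun l _ => by ring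
  rcases (Metric.sphere (0 : EuclideanSpace ℝ (Fin d)) 1).eq_empty_or_nonempty with he | hne
  · refine ⟨1, one_pos, fun u hu => ?_⟩
    have : u ∈ Metric.sphere (0 : EuclideanSpace ℝ (Fin d)) 1 := by simpa using hu
    rw [he] at this
    exact this.elim
  · obtain ⟨u, hu, hmin⟩ := (isCompact_sphere _ _).exists_isMinOn hne hcont.continuousOn
    exact ⟨f u, hpos u (by simpa using hu), fun v hv => hmin (by simpa using hv)⟩

section Main

variable {Ω : Type*} [MeasurableSpace Ω] {μ : Measure Ω} {d : ℕ} {ζ : ℝ}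
  {β : EuclideanSpace ℝ (Fin d)} {x : ℕ → EuclideanSpace ℝ (Fin d)} {lam : ℝ → ℝ}
  {T C : ℕ → Ω → ℝ} {τ : ℕ → ℝ} {W K : ℝ}
  {B : Set (EuclideanSpace ℝ (Fin d))} {s0 : EuclideanSpace ℝ (Fin d) → ℝ → ℝ}
  {s1 : EuclideanSpace ℝ (Fin d) → ℝ → EuclideanSpace ℝ (Fin d)}
  {s2 : EuclideanSpace ℝ (Fin d) → ℝ → Matrix (Fin d) (Fin d) ℝ}

theorem IsGroupedCoxModel.cumHazard_nonneg (h : IsGroupedCoxModel μ ζ β x lam T C τ W K) :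
    0 ≤ cumHazard lam ζ :=
  intervalIntegral.integral_nonneg h.length_nonneg fun t _ => h.model.hazard_nonneg t

/-- The normalized score of the Breslow likelihood at the true parameter is negligible. -/
theorem highProb_score_le [IsProbabilityMeasure μ] (h : IsGroupedCoxModel μ ζ β x lam T C τ W K)
    (hstab : StabilityConditions μ ζ β lam (sampleData x T C τ) B s0 s1 s2) {R : ℝ}
    (hR : ∀ i, ‖x i‖ ≤ R) {ε : ℝ} (hε : 0 < ε) :
    HighProb μ fun n ω => ∀ u : EuclideanSpace ℝ (Fin d), ‖u‖ = 1 →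
      (sampleData x T C τ n ω).score (τ n) ζ β u ≤ ε * n := by
  have hR0 : 0 ≤ R := (norm_nonneg _).trans (hR 0)
  have hΛ := h.cumHazard_nonneg
  obtain ⟨m₀, K₀, hm₀, hK₀, hb⟩ := hstab.exists_bounds
  obtain ⟨m, K', hm, hK', hclose⟩ := hstab.exists_momentsClose_imp
  -- the coordinates of the score
  have hcoord : ∀ k : Fin d, ∀ ε > 0, HighProb μ fun n ω =>
      |(sampleData x T C τ n ω).score (τ n) ζ β (EuclideanSpace.single k 1)| ≤ ε * n := by
    intro k ε hε
    have hη : 0 < ε / (2 * (1 + K' * cumHazard lam ζ)) := by positivity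
    obtain ⟨δ, hδ, hδ'⟩ := hclose _ hη
    set η := ε / (2 * (1 + K' * cumHazard lam ζ)) with hηdef
    have hLLN := h.highProb_sum_events (A := R + K₀ / m₀) (by positivity)
      (fun n (i : Fin n) t => x i k - s1 β t k / s0 β t) (fun n i t ht =>
        (abs_sub _ _).trans (add_le_add (((PiLp.norm_apply_le (x i) k).trans (hR i)))
          ((hb β hstab.mem t (mem_Icc_of_mem_grid (h.mesh_pos n) h.length_nonneg ht)).2.2.2.2.1 k)))
      (half_pos hε)
    refine (hLLN.and (hstab.highProb_momentsClose hδ)).mono ?_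
    filter_upwards [eventually_gt_atTop 0] with n hn ω hω
    obtain ⟨m', hm'⟩ := h.exists_mul n
    obtain ⟨h1, h2⟩ := hω
    have hn' : (0 : ℝ) < n := by exact_mod_cast hn
    set D := sampleData x T C τ n ω with hD
    have hper : ∀ t ∈ grid (τ n) ζ,
        |(∑ i ∈ D.events t, inner ℝ (D.x i) (EuclideanSpace.single k 1) -
          (D.events t).card * (inner ℝ (D.S1 β t) (EuclideanSpace.single k 1) / D.S0 β t)) -
        (∑ i ∈ D.events t, (x i k - s1 β t k / s0 β t) -
          (cumHazard lam t - cumHazard lam (t - τ n)) *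
          ∑ i ∈ D.atRisk t, (x i k - s1 β t k / s0 β t) * Real.exp (inner ℝ (x i) β))| ≤
        η * (D.events t).card +
          η * (K' * n) * (cumHazard lam t - cumHazard lam (t - τ n)) := by
      intro t ht
      obtain ⟨_, -, g0, g1⟩ := exists_of_mem_grid (h.mesh_pos n) h.length_nonneg ht
      have hτn := h.mesh_pos n
      have hL := sub_nonneg.2 (cumHazard_mono h.integrable h.model.hazard_nonneg
        ⟨g0, by linarith⟩ ⟨by linarith, g1⟩ (by linarith : t - τ n ≤ t))
      obtain ⟨c1, c2, c3, -, -⟩ := hδ' n hn D h2 β hstab.mem t ⟨by linarith, g1⟩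
      have hS0 : 0 < D.S0 β t := lt_of_lt_of_le (by positivity) c1
      have e1 : ∑ i ∈ D.events t, inner ℝ (D.x i) (EuclideanSpace.single k 1) =
          ∑ i ∈ D.events t, x i k := by
        simp [hD, groupedData, EuclideanSpace.inner_single_right]
      have e2 : ∑ i ∈ D.atRisk t, (x i k - s1 β t k / s0 β t) * Real.exp (inner ℝ (x i) β) =
          D.S0 β t * (D.S1 β t k / D.S0 β t - s1 β t k / s0 β t) := by
        have e3 : ∑ i ∈ D.atRisk t, x i k * Real.exp (inner ℝ (x i) β) = D.S1 β t k := by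
          simp [SurvivalData.S1, hD, groupedData, mul_comm]
        have e4 : ∑ i ∈ D.atRisk t, Real.exp (inner ℝ (x i) β) = D.S0 β t := rfl
        simp only [sub_mul, Finset.sum_sub_distrib, ← Finset.mul_sum, e3, e4]
        field_simp
      rw [e1, e2, Finset.sum_sub_distrib, Finset.sum_const, nsmul_eq_mul]
      simp only [EuclideanSpace.inner_single_right, conj_trivial, one_mul]
      set q := D.S1 β t k / D.S0 β t - s1 β t k / s0 β t with hq
      set L := cumHazard lam t - cumHazard lam (t - τ n) with hLdef
      -- the compensator is itself negligible, because the weights are centred at the limiting mean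
      have hqk := c3 k
      rw [← hq] at hqk
      calc _ = |-((D.events t).card * q) + D.S0 β t * q * L| := by
            congr 1; rw [hq]; ring
        _ ≤ |-((D.events t).card * q)| + |D.S0 β t * q * L| := abs_add_le _ _
        _ = |q| * (D.events t).card + |q| * D.S0 β t * L := by
            rw [abs_neg, abs_mul, abs_mul, abs_mul, Nat.abs_cast, abs_of_pos hS0,
              abs_of_nonneg hL]
            ring
        _ ≤ _ := by gcongr
    have hsum := (Finset.abs_sum_le_sum_abs _ _).trans (Finset.sum_le_sum hper)
    rw [Finset.sum_sub_distrib, Finset.sum_add_distrib, ← Finset.mul_sum, ← Finset.mul_sum,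
      sum_grid_cumHazard (h.mesh_pos n) hm'] at hsum
    have hcard := mul_le_mul_of_nonneg_left (D.sum_card_events_le (grid (τ n) ζ)) hη.le
    have hηeq : η * (1 + K' * cumHazard lam ζ) = ε / 2 := by
      rw [hηdef]; field_simp
    have h3 := abs_sub_abs_le_abs_sub (D.score (τ n) ζ β (EuclideanSpace.single k 1))
      (∑ t ∈ grid (τ n) ζ, (∑ i ∈ D.events t, (x i k - s1 β t k / s0 β t) -
          (cumHazard lam t - cumHazard lam (t - τ n)) *
          ∑ i ∈ D.atRisk t, (x i k - s1 β t k / s0 β t) * Real.exp (inner ℝ (x i) β)))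
    have h4 := h3.trans hsum
    nlinarith
  refine (HighProb.forall_fintype fun k => hcoord k (ε / (d + 1)) (by positivity)).mono
    (Eventually.of_forall fun n ω hω u hu => ?_)
  rw [SurvivalData.score_eq_sum]
  calc _ ≤ ∑ _k : Fin d, ε / (d + 1) * n := by
        refine Finset.sum_le_sum fun k _ => (le_abs_self _).trans ?_
        rw [abs_mul]
        have h1 : |u k| ≤ 1 := by
          have := PiLp.norm_apply_le u k
          rwa [hu] at this
        exact (mul_le_mul h1 (hω k) (abs_nonneg _) zero_le_one).trans_eq (one_mul _)
    _ = ε * (d / (d + 1)) * n := by simp; ring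
    _ ≤ ε * 1 * n := by
        gcongr
        exact div_le_one_of_le₀ (by linarith) (by positivity)
    _ = ε * n := by ring

/-- Near the true parameter, the normalized Breslow information is close to its limit. -/
theorem highProb_breslowInfo [IsProbabilityMeasure μ]
    (h : IsGroupedCoxModel μ ζ β x lam T C τ W K)
    (hstab : StabilityConditions μ ζ β lam (sampleData x T C τ) B s0 s1 s2)
    {ε : ℝ} (hε : 0 < ε) :
    ∃ r > 0, (∀ b, dist b β ≤ r → b ∈ B) ∧ HighProb μ fun n ω => ∀ b, dist b β ≤ r → ∀ k l,
      |(sampleData x T C τ n ω).breslowInfo (τ n) ζ b k l / n -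
        limitSigma s0 s1 s2 lam ζ β k l| ≤ ε := by
  have hΛ := h.cumHazard_nonneg
  obtain ⟨m₀, K₀, hm₀, hK₀, hb⟩ := hstab.exists_bounds
  obtain ⟨m, K', hm, hK', hclose⟩ := hstab.exists_momentsClose_imp
  have hη : 0 < ε / (2 * (2 + (K' + 1) * cumHazard lam ζ)) := by positivity
  obtain ⟨δ, hδ, hδ'⟩ := hclose _ hη
  obtain ⟨r, hr, hr'⟩ := hstab.exists_dist_limitV_le hη
  set η := ε / (2 * (2 + (K' + 1) * cumHazard lam ζ)) with hηdef
  have hηeq : η * (2 + (K' + 1) * cumHazard lam ζ) = ε / 2 := by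
    rw [hηdef]; field_simp
  refine ⟨r, hr, fun b hb => (hr' b hb).1, ?_⟩
  have hLLN := HighProb.forall_fintype fun k : Fin d => HighProb.forall_fintype fun l : Fin d =>
    h.highProb_sum_events (A := K₀ / m₀ + (K₀ / m₀) ^ 2) (by positivity)
    (fun n (_ : Fin n) t => limitV s0 s1 s2 β t k l) (fun n _ t ht =>
      (hb β hstab.mem t (mem_Icc_of_mem_grid (h.mesh_pos n) h.length_nonneg ht)).2.2.2.2.2 k l)
    (half_pos hε)
  refine (hLLN.and (hstab.highProb_momentsClose hδ)).mono ?_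
  filter_upwards [eventually_gt_atTop 0] with n hn ω hω b hbr k l
  obtain ⟨m', hm'⟩ := h.exists_mul n
  obtain ⟨h1, h2⟩ := hω
  replace h1 := h1 k l
  have hn' : (0 : ℝ) < n := by exact_mod_cast hn
  set D := sampleData x T C τ n ω with hD
  set v : ℝ → ℝ := fun t => limitV s0 s1 s2 β t k l with hv
  have hc := hδ' n hn D h2
  have hgrid : ∀ t ∈ grid (τ n) ζ, t ∈ Icc 0 ζ := fun t ht =>
    mem_Icc_of_mem_grid (h.mesh_pos n) h.length_nonneg ht
  have e0 : ∀ t, ∑ i ∈ D.atRisk t, v t * Real.exp (inner ℝ (x i) β) = v t * D.S0 β t := fun t => by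
    rw [← Finset.mul_sum]; rfl
  -- `b` may be replaced by `β`, and the covariance of the data by the limiting covariance
  have hA : |D.breslowInfo (τ n) ζ b k l - ∑ t ∈ grid (τ n) ζ, (D.events t).card * v t| ≤
      2 * η * n := by
    rw [D.breslowInfo_eq, ← Finset.sum_sub_distrib]
    refine (Finset.abs_sum_le_sum_abs _ _).trans ?_
    calc _ ≤ ∑ t ∈ grid (τ n) ζ, 2 * η * (D.events t).card := by
          refine Finset.sum_le_sum fun t ht => ?_
          rw [← mul_sub, abs_mul, Nat.abs_cast, mul_comm]
          gcongr
          have a1 := (hc b (hr' b hbr).1 t (hgrid t ht)).2.2.2.1 k l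
          have a2 := (hr' b hbr).2 t (hgrid t ht) k l
          have a3 := abs_sub_le (limitV D.S0 D.S1 D.S2 b t k l) (limitV s0 s1 s2 b t k l) (v t)
          linarith
      _ ≤ _ := by
          rw [← Finset.mul_sum]
          gcongr
          exact D.sum_card_events_le _
  have hBd : |∑ t ∈ grid (τ n) ζ, (D.events t).card * v t - ∑ t ∈ grid (τ n) ζ,
      (cumHazard lam t - cumHazard lam (t - τ n)) * (v t * D.S0 β t)| ≤ ε / 2 * n := by
    rw [← Finset.sum_sub_distrib]
    refine le_of_eq_of_le (congrArg _ (Finset.sum_congr rfl fun t _ => ?_)) h1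
    rw [Finset.sum_const, nsmul_eq_mul, ← e0]
  have hCd := abs_sum_grid_sub_integral_le h.integrable h.model.hazard_nonneg (h.mesh_pos n)
    h.length_nonneg hm' (g := fun t => v t * (D.S0 β t / n)) (φ := fun s => v s * s0 β s)
    (ε := η * (K' + 1)) (hstab.intervalIntegrable h.length_nonneg k l) (by
      intro t ht s hs
      have hst : D.atRisk s = D.atRisk t :=
        atRisk_groupedData_eq (h.mesh_pos n) h.length_nonneg ht hs
      have hs' : s ∈ Icc 0 ζ := by
        obtain ⟨_, -, g0, g1⟩ := exists_of_mem_grid (h.mesh_pos n) h.length_nonneg ht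
        exact ⟨by linarith [hs.1], hs.2.trans g1⟩
      have a0 : D.S0 β s = D.S0 β t := by unfold SurvivalData.S0; rw [hst]
      have a1 : limitV D.S0 D.S1 D.S2 β s k l = limitV D.S0 D.S1 D.S2 β t k l := by
        simp only [limitV, SurvivalData.S0, SurvivalData.S1, SurvivalData.S2, hst, Matrix.of_apply]
      -- the moments of the data agree at `s` and `t`, so the limit need only be compared at one
      -- time with the data
      have a2 := (hc β hstab.mem s hs').2.2.2.2 k l
      rw [a0, a1] at a2
      obtain ⟨a3, a4, -, a5, -⟩ := hc β hstab.mem t (hgrid t ht)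
      have a6 := a5 k l
      have a7 : 0 ≤ D.S0 β t / n := by have := D.S0_nonneg β t; positivity
      have a8 : D.S0 β t / n ≤ K' := (div_le_iff₀ hn').2 a4
      have a9 := abs_sub_le (v t * (D.S0 β t / n))
        (limitV D.S0 D.S1 D.S2 β t k l * (D.S0 β t / n)) (v s * s0 β s)
      rw [← sub_mul, abs_mul, abs_of_nonneg a7, abs_sub_comm (v t)] at a9
      have a10 := mul_le_mul a6 a8 a7 hη.le
      change |v t * (D.S0 β t / n) - v s * s0 β s| ≤ _
      linarith)
  have hsig : limitSigma s0 s1 s2 lam ζ β k l = ∫ s in (0 : ℝ)..ζ, v s * s0 β s * lam s := rfl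
  have hCn : ∑ t ∈ grid (τ n) ζ,
      v t * (D.S0 β t / n) * (cumHazard lam t - cumHazard lam (t - τ n)) =
      (∑ t ∈ grid (τ n) ζ, (cumHazard lam t - cumHazard lam (t - τ n)) * (v t * D.S0 β t)) / n := by
    rw [Finset.sum_div]
    exact Finset.sum_congr rfl fun t _ => by ring
  rw [hCn, ← hsig] at hCd
  have f1 := abs_sub_le (D.breslowInfo (τ n) ζ b k l)
    (∑ t ∈ grid (τ n) ζ, (D.events t).card * v t)
    (∑ t ∈ grid (τ n) ζ, (cumHazard lam t - cumHazard lam (t - τ n)) * (v t * D.S0 β t))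
  have f2 : |D.breslowInfo (τ n) ζ b k l / n -
      (∑ t ∈ grid (τ n) ζ, (cumHazard lam t - cumHazard lam (t - τ n)) * (v t * D.S0 β t)) / n| ≤
      2 * η + ε / 2 := by
    rw [← sub_div, abs_div, Nat.abs_cast, div_le_iff₀ hn']
    linarith
  have f3 := abs_sub_le (D.breslowInfo (τ n) ζ b k l / n)
    ((∑ t ∈ grid (τ n) ζ, (cumHazard lam t - cumHazard lam (t - τ n)) * (v t * D.S0 β t)) / n)
    (limitSigma s0 s1 s2 lam ζ β k l)
  linarith

/-- The Poisson-binomial and the Breslow log-likelihood differ by `o(n)`, uniformly on `B`. -/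
theorem highProb_log_pbLik [IsProbabilityMeasure μ]
    (h : IsGroupedCoxModel μ ζ β x lam T C τ W K)
    (hstab : StabilityConditions μ ζ β lam (sampleData x T C τ) B s0 s1 s2)
    (hW : ∀ b ∈ B, ∀ i, Real.exp (inner ℝ (x i) b) ≤ W) {dLam : ℕ → Ω → ℝ → ℝ}
    (hplug : IsPlugIn μ ζ τ (sampleData x T C τ) dLam) {ε : ℝ} (hε : 0 < ε) :
    HighProb μ fun n ω => ∀ b ∈ B, 0 < (sampleData x T C τ n ω).pbLik (τ n) ζ (dLam n ω) b ∧
      |Real.log ((sampleData x T C τ n ω).pbLik (τ n) ζ (dLam n ω) b) -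
        Real.log ((sampleData x T C τ n ω).breslowLik (τ n) ζ b)| ≤ ε * n := by
  have hW0 : 0 < W := (Real.exp_pos _).trans_le (h.risk_le 0)
  obtain ⟨m, K', hm, hK', hclose⟩ := hstab.exists_momentsClose_imp
  obtain ⟨δ, hδ, hδ'⟩ := hclose 1 one_pos
  obtain ⟨Kp, hKp, hp⟩ := hplug.highProb
  -- the first bound keeps `d(t) W` below half of `S0`, the second bounds the total error
  set ε' := min (m / (2 * W)) (ε / (W * Kp + 2 * W / m)) with hε'
  have hε'0 : 0 < ε' := by positivity
  refine ((h.highProb_card_events_le hε'0).and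
    ((hstab.highProb_momentsClose hδ).and hp)).mono ?_
  filter_upwards [eventually_gt_atTop 0] with n hn ω hω b hb
  obtain ⟨h1, h2, h3⟩ := hω
  have hgrid : ∀ t ∈ grid (τ n) ζ, t ∈ Icc 0 ζ := fun t ht =>
    mem_Icc_of_mem_grid (h.mesh_pos n) h.length_nonneg ht
  obtain ⟨g1, g2⟩ := (sampleData x T C τ n ω).abs_log_pbLik_sub_log_breslowLik_le
    (b := b) (dLam := dLam n ω) (τ := τ n) (ζ := ζ) hW0.le hKp hm (ε := ε') (by
      have := (le_div_iff₀ (by positivity)).1 (min_le_left (m / (2 * W)) (ε / (W * Kp + 2 * W / m)))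
      linarith) hε'0.le (fun i => hW b hb i) (fun t ht => (hδ' n hn _ h2 b hb t (hgrid t ht)).1)
    (fun t ht => (h3 t ht).1) (fun t ht => (h3 t ht).2.1) (fun t ht => (h3 t ht).2.2) h1
  refine ⟨g1, g2.trans ?_⟩
  gcongr
  exact (le_div_iff₀ (by positivity)).1
    (min_le_right (m / (2 * W)) (ε / (W * Kp + 2 * W / m)))

/-- Consistency of the Poisson-binomial estimator. -/
theorem highProb_dist_lt [IsProbabilityMeasure μ]
    (h : IsGroupedCoxModel μ ζ β x lam T C τ W K)
    (hstab : StabilityConditions μ ζ β lam (sampleData x T C τ) B s0 s1 s2)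
    {R : ℝ} (hR : ∀ i, ‖x i‖ ≤ R)
    (hW : ∀ b ∈ B, ∀ i, Real.exp (inner ℝ (x i) b) ≤ W) {dLam : ℕ → Ω → ℝ → ℝ}
    (hplug : IsPlugIn μ ζ τ (sampleData x T C τ) dLam)
    {βpb : ℕ → Ω → EuclideanSpace ℝ (Fin d)}
    (hβpb : HighProb μ fun n ω => βpb n ω ∈ B ∧
      IsMaxOn (fun b => (sampleData x T C τ n ω).pbLik (τ n) ζ (dLam n ω) b) B (βpb n ω))
    {ε : ℝ} (hε : 0 < ε) : HighProb μ fun n ω => dist (βpb n ω) β < ε := by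
  obtain ⟨c, hc, hcS⟩ := exists_pos_le_of_posDef (hstab.posDef β hstab.mem)
  obtain ⟨r₀, hr₀, -, hinfo⟩ := highProb_breslowInfo h hstab
    (ε := c / 2 / (d ^ 2 + 1)) (by positivity)
  set r := min r₀ ε with hr
  have hr0 : 0 < r := by positivity
  have hscore := highProb_score_le h hstab hR (ε := c / 2 * r / 4) (by positivity)
  have hlik := highProb_log_pbLik h hstab hW hplug (ε := c / 2 * r ^ 2 / 16) (by positivity)
  refine (hinfo.and (hscore.and (hlik.and hβpb))).mono ?_
  filter_upwards [eventually_gt_atTop 0] with n hn ω hω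
  obtain ⟨h1, h2, h3, hB, hmax⟩ := hω
  have hn' : (0 : ℝ) < n := by exact_mod_cast hn
  by_contra! hcon
  set D := sampleData x T C τ n ω with hD
  -- the error `c r² / 32` of the likelihood comparison at two points is less than the drop
  -- `c r² / 8` of the Breslow log-likelihood
  have hdrop := D.log_breslowLik_sub_le hn (half_pos hc) hr0 h2 (b := βpb n ω) (by
    intro b' hb' u hu
    rw [D.info_eq_sum]
    have hq : |(∑ k, ∑ l, u k * u l * D.breslowInfo (τ n) ζ b' k l) / n -
        ∑ k, ∑ l, u k * u l * limitSigma s0 s1 s2 lam ζ β k l| ≤ c / 2 := by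
      have hu1 : ∀ k, |u k| ≤ 1 := fun k => by
        have := PiLp.norm_apply_le u k
        rwa [hu] at this
      simp only [Finset.sum_div, ← Finset.sum_sub_distrib]
      calc _ ≤ ∑ _k : Fin d, ∑ _l : Fin d, c / 2 / ((d : ℝ) ^ 2 + 1) := by
            refine (Finset.abs_sum_le_sum_abs _ _).trans (Finset.sum_le_sum fun k _ =>
              (Finset.abs_sum_le_sum_abs _ _).trans (Finset.sum_le_sum fun l _ => ?_))
            rw [mul_div_assoc, ← mul_sub, abs_mul, abs_mul]
            have a1 : |u k| * |u l| ≤ 1 := mul_le_one₀ (hu1 k) (abs_nonneg _) (hu1 l)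
            exact (mul_le_mul a1 (h1 b' (hb'.trans (min_le_left _ _)) k l) (abs_nonneg _)
              zero_le_one).trans_eq (one_mul _)
        _ = c / 2 * ((d : ℝ) ^ 2 / ((d : ℝ) ^ 2 + 1)) := by simp; ring
        _ ≤ c / 2 * 1 := by
            gcongr
            exact div_le_one_of_le₀ (by linarith) (by positivity)
        _ = c / 2 := mul_one _
    have h5 := hcS u hu
    have h6 := (abs_le.1 hq).1
    rw [← le_div_iff₀ hn']
    linarith) ((min_le_right _ _).trans hcon)
  obtain ⟨-, l1⟩ := h3 _ hB
  obtain ⟨l2, l3⟩ := h3 β hstab.mem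
  have l4 := Real.log_le_log l2 (hmax hstab.mem)
  have l5 := abs_le.1 l1
  have l6 := abs_le.1 l3
  have l7 : 0 < c / 2 * r ^ 2 * n := by positivity
  linarith [l5.2, l6.1]

end Main

end GroupedCox

theorem theorem5 {Ω : Type*} [MeasurableSpace Ω] (μ : Measure Ω) [IsProbabilityMeasure μ]
    {d : ℕ} (ζ : ℝ) (hζ : 0 < ζ)
    (β : EuclideanSpace ℝ (Fin d)) (x : ℕ → EuclideanSpace ℝ (Fin d)) (lam : ℝ → ℝ)
    (T C : ℕ → Ω → ℝ)
    -- the underlying continuous Cox model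
    (hmodel : GroupedCox.IsCoxModel μ ζ β x lam T C)
    -- the grouping parameter: the end of the study is a multiple of it, and it is of order `1 / n`
    (τ : ℕ → ℝ) (hτ_pos : ∀ n, 0 < τ n) (hτ_mul : ∀ n, ∃ m : ℕ, ζ = m * τ n)
    (hτ_order : τ =Θ[atTop] (fun n : ℕ => 1 / (n : ℝ)))
    -- the grouped data of the first `n` subjects
    (D : (n : ℕ) → Ω → GroupedCox.SurvivalData d n)
    (hD : ∀ n ω, D n ω = GroupedCox.groupedData x (fun i => T i ω) (fun i => C i ω) (τ n) n)
    -- at least one subject at risk at the end of the study has no event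
    (hend : Tendsto (fun n => μ {ω |
      ¬ (((D n ω).events ζ).card + 1 ≤ ((D n ω).atRisk ζ).card)}) atTop (𝓝 0))
    -- bounded covariates
    (hx : ∃ M : Set (EuclideanSpace ℝ (Fin d)), IsCompact M ∧ ∀ i, x i ∈ M)
    -- the jumps of the grouped baseline cumulative hazard are of order `τ`
    (hjump : ∃ K : ℝ, 0 < K ∧ ∀ᶠ n in atTop, ∀ t ∈ GroupedCox.grid (τ n) ζ,
      GroupedCox.cumHazard lam t - GroupedCox.cumHazard lam (t - τ n) ≤ K * τ n)
    -- the fraction of subjects at risk converges almost surely, uniformly in time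
    (y : ℝ → ℝ) (hy : ∀ t ∈ Icc (0 : ℝ) ζ, y t ∈ Ioc (0 : ℝ) 1)
    (hrisk : ∀ᵐ ω ∂μ, TendstoUniformlyOn
      (fun (n : ℕ) t => (((D n ω).atRisk t).card : ℝ) / n) y atTop (Icc 0 ζ))
    -- stability and regularity conditions on a neighborhood `B` of `β`
    (B : Set (EuclideanSpace ℝ (Fin d))) (s0 : EuclideanSpace ℝ (Fin d) → ℝ → ℝ)
    (s1 : EuclideanSpace ℝ (Fin d) → ℝ → EuclideanSpace ℝ (Fin d))
    (s2 : EuclideanSpace ℝ (Fin d) → ℝ → Matrix (Fin d) (Fin d) ℝ)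
    (hstab : GroupedCox.StabilityConditions μ ζ β lam D B s0 s1 s2)
    -- the plugged-in estimate of the baseline hazard
    (dLam : ℕ → Ω → ℝ → ℝ) (hplug : GroupedCox.IsPlugIn μ ζ τ D dLam)
    -- the Poisson-binomial estimator: it lies in `B` and maximizes the likelihood there
    (βpb : ℕ → Ω → EuclideanSpace ℝ (Fin d))
    (hβpb : Tendsto (fun n => μ {ω | ¬ (βpb n ω ∈ B ∧
      IsMaxOn (fun b => (D n ω).pbLik (τ n) ζ (dLam n ω) b) B (βpb n ω))}) atTop (𝓝 0)) :
    TendstoInMeasure μ βpb atTop (fun _ => β) ∧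
    ∀ k l, TendstoInMeasure μ
      (fun n ω => (D n ω).breslowInfo (τ n) ζ (βpb n ω) k l / (n : ℝ)) atTop
      (fun _ => GroupedCox.limitSigma s0 s1 s2 lam ζ β k l) := by
  obtain rfl : D = GroupedCox.sampleData x T C τ := by
    funext n ω
    exact hD n ω
  obtain ⟨M, hM, hxM⟩ := hx
  obtain ⟨R, hR⟩ := hM.isBounded.exists_norm_le
  obtain ⟨Q, hQ⟩ := hstab.isBounded.exists_norm_le
  have hxR : ∀ i, ‖x i‖ ≤ R := fun i => hR _ (hxM i)
  have hW : ∀ b ∈ B, ∀ i, Real.exp (inner ℝ (x i) b) ≤ Real.exp (R * Q) := fun b hb i =>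
    Real.exp_le_exp.2 ((real_inner_le_norm _ _).trans (mul_le_mul (hxR i) (hQ b hb)
      (norm_nonneg _) ((norm_nonneg _).trans (hxR i))))
  obtain ⟨K, -, hK⟩ := hjump
  have hτ0 : Tendsto τ atTop (𝓝 0) :=
    hτ_order.isBigO.trans_tendsto tendsto_one_div_atTop_nhds_zero_nat
  have h : GroupedCox.IsGroupedCoxModel μ ζ β x lam T C τ (Real.exp (R * Q)) K :=
    ⟨hmodel, hstab.hazard_integrable, hτ_pos, hζ.le, hτ_mul, hτ0, hK, hW β hstab.mem⟩
  have hcons : ∀ ε > 0, GroupedCox.HighProb μ fun n ω => dist (βpb n ω) β < ε := fun ε hε =>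
    GroupedCox.highProb_dist_lt h hstab hxR hW hplug hβpb hε
  refine ⟨GroupedCox.tendstoInMeasure_of_highProb hcons, fun k l =>
    GroupedCox.tendstoInMeasure_of_highProb fun ε hε => ?_⟩
  obtain ⟨r, hr, -, hinfo⟩ := GroupedCox.highProb_breslowInfo h hstab (half_pos hε)
  refine (hinfo.and (hcons r hr)).mono (Eventually.of_forall fun n ω hω => ?_)
  rw [Real.dist_eq]
  exact (hω.1 _ hω.2.le k l).trans_lt (half_lt_self hε)
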